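/- **Theorem.** Let $r$ be a positive integer, let $G$ be a finite nonempty undirected graph with positive edge weights (not necessarily connected) that does not contain $K_r$ as a minor, and let $\Delta>0$ be a real number. Then $G$ admits a $(\Delta,\Delta/r,r-1)$-buffered cop decomposition. That is, there are: a partition of $V(G)$ into vertex-disjoint sets $\eta$, called supernodes (each identified with the subgraph of $G$ that it induces); for every supernode $\eta$ a tree $T_\eta\subseteq\eta$, called its skeleton; and a rooted tree $\mathcal T$ (the partition tree) whose nodes are the supernodes, with the following properties. Here $\mathrm{dom}(\eta)$ is the subgraph of $G$ induced by the union of all supernodes in the subtree of $\mathcal T$ rooted at $\eta$; $\mathrm{dist}_H$ is the weighted shortest-path distance inside the subgraph $H$ ($\infty$ if there is no path); and two disjoint supernodes are adjacent if an edge of $G$ joins them. 1. (Supernode radius) For every supernode $\eta$ and every $v\in\eta$, $\mathrm{dist}_\eta(v,T_\eta)\le\Delta$. 2. (Shortest-path skeleton) For every supernode $\eta$, $T_\eta$ is a single-source shortest path tree in $\mathrm{dom}(\eta)$, i.e. it has a vertex $s$ with $\mathrm{dist}_{T_\eta}(s,v)=\mathrm{dist}_{\mathrm{dom}(\eta)}(s,v)$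 for all $v\in V(T_\eta)$ ($T_\eta$ need not span $\mathrm{dom}(\eta)$), and $T_\eta$ has at most $r-1$ leaves (vertices of degree at most $1$ in $T_\eta$). 3. (Supernode buffer) If a supernode $X$ is a proper ancestor of a supernode $\eta$ in $\mathcal T$, then either $\eta$ and $X$ are adjacent in $G$, or $\mathrm{dist}_{\mathrm{dom}(X)}(v,X)\ge\Delta/r$ for every vertex $v$ of $\mathrm{dom}(\eta)$. 4. (Tree decomposition) For a supernode $\eta$ let its bag $B_\eta$ consist of $\eta$ and all proper ancestors of $\eta$ in $\mathcal T$ that are adjacent to $\eta$ in $G$. Then every bag contains at most $r-1$ supernodes, and the tree $\mathcal T$ with the vertex sets $\bigcup B_\eta$ as bags (the expansion of $\mathcal T$) is a tree decomposition of $G$: every vertex and every edge of $G$ is contained in some bag, and if a vertex lies in two bags, it lies in every bag on the path of $\mathcal T$ between them. -/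

import Mathlib

open scoped NNReal ENNReal

universe u

namespace BufferedCop

/-! ### Minors -/

/-- `H` is a minor of `G`: there is a model of `H` in `G`, that is, a family of pairwise disjoint
(nonempty) connected branch sets `B a`, one for every vertex `a` of `H`, such that the branch sets
of any two adjacent vertices of `H` are joined by an edge of `G`. -/
def IsMinor {W V : Type*} (H : SimpleGraph W) (G : SimpleGraph V) : Prop :=
  ∃ B : W → Set V,
    (∀ a, (G.induce (B a)).Connected) ∧
    (∀ a b, a ≠ b → Disjoint (B a) (B b)) ∧
    ∀ a b, H.Adj a b → ∃ x ∈ B a, ∃ y ∈ B b, G.Adj x y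

/-- `G` is `K_r`-minor-free. -/
def CliqueMinorFree {V : Type*} (G : SimpleGraph V) (r : ℕ) : Prop :=
  ¬ IsMinor (SimpleGraph.completeGraph (Fin r)) G

/-! ### Weighted distances in subgraphs -/

section Distance

variable {V : Type*} {G : SimpleGraph V}

/-- The length of a walk: the sum of the weights of its edges, with multiplicity. -/
def walkLength (w : Sym2 V → ℝ≥0) {a b : V} (p : G.Walk a b) : ℝ≥0 :=
  (p.edges.map w).sum

/-- The subgraph of `G` induced by a set of vertices. -/
def inducedOn (G : SimpleGraph V) (S : Set V) : G.Subgraph :=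
  (⊤ : G.Subgraph).induce S

/-- `dist_H(a, b)`: the infimum of the lengths of the walks from `a` to `b` that use only
vertices and edges of the subgraph `H`; it is `∞` if there is no such walk. -/
noncomputable def subDist (w : Sym2 V → ℝ≥0) (H : G.Subgraph) (a b : V) : ℝ≥0∞ :=
  ⨅ (p : G.Walk a b) (_ : p.toSubgraph ≤ H), (walkLength w p : ℝ≥0∞)

/-- `dist_H(a, S)`: the distance in `H` from a vertex to a set of vertices. -/
noncomputable def subDistSet (w : Sym2 V → ℝ≥0) (H : G.Subgraph) (a : V) (S : Set V) : ℝ≥0∞ :=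
  ⨅ s ∈ S, subDist w H a s

/-- `T` is a single-source shortest path (SSSP) tree in `H`: a tree contained in `H` with a
source `s` such that, for every vertex `v` of `T`, the path from `s` to `v` in `T` is a
shortest path in `H`. The tree need not span `H`. -/
def IsSSSPTree (w : Sym2 V → ℝ≥0) (H T : G.Subgraph) : Prop :=
  T.coe.IsTree ∧ T ≤ H ∧
    ∃ s ∈ T.verts, ∀ v ∈ T.verts, subDist w T s v = subDist w H s v

/-- The leaves of a tree `T`: its vertices of degree at most one (so the source counts if it has
degree one, and the vertex of a one-vertex tree is a leaf). -/
def leaves (T : G.Subgraph) : Set V :=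
  {v | v ∈ T.verts ∧ (T.neighborSet v).encard ≤ 1}

/-- Two sets of vertices are adjacent in `G` if some edge of `G` joins them. -/
def AdjSets (G : SimpleGraph V) (S S' : Set V) : Prop :=
  ∃ x ∈ S, ∃ y ∈ S', G.Adj x y

end Distance

/-! ### Tree decompositions -/

/-- The tree `T` with the bags `B i` is a tree decomposition of `G`: the bags cover the vertices
and the edges of `G`, and if a vertex lies in two bags then it lies in all bags on the path of `T`
between them. -/
def IsTreeDecomposition {V ι : Type*} (G : SimpleGraph V) (T : SimpleGraph ι) (B : ι → Set V) :
    Prop :=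
  T.IsTree ∧
  (∀ v, ∃ i, v ∈ B i) ∧
  (∀ x y, G.Adj x y → ∃ i, x ∈ B i ∧ y ∈ B i) ∧
  ∀ v i j, v ∈ B i → v ∈ B j → ∀ p : T.Walk i j, p.IsPath → ∀ k ∈ p.support, v ∈ B k

/-! ### Buffered cop decompositions -/

/-- A partition of the vertices of `G` into supernodes, indexed by `ι`, each containing a skeleton
(a tree), with a rooted partition tree whose nodes are the supernodes. -/
structure CopDecomposition {V : Type*} (G : SimpleGraph V) (ι : Type*) where
  /-- the vertex set of a supernode -/
  supernode : ι → Set V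
  /-- the supernodes are pairwise disjoint -/
  disjoint : ∀ i j, i ≠ j → Disjoint (supernode i) (supernode j)
  /-- the supernodes cover the graph -/
  cover : ∀ v, ∃ i, v ∈ supernode i
  /-- the skeleton of a supernode -/
  skeleton : ι → G.Subgraph
  /-- every skeleton is a (nonempty) tree -/
  skeleton_isTree : ∀ i, (skeleton i).coe.IsTree
  /-- every skeleton is contained in the subgraph induced by its supernode -/
  skeleton_le : ∀ i, skeleton i ≤ inducedOn G (supernode i)
  /-- the partition tree -/
  tree : SimpleGraph ι
  /-- the partition tree is a tree -/
  tree_isTree : tree.IsTree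
  /-- the root of the partition tree -/
  root : ι

namespace CopDecomposition

variable {V : Type*} {G : SimpleGraph V} {ι : Type*} (D : CopDecomposition G ι)

/-- `i` is an ancestor of `j` or equal to `j`: it lies on the path of the partition tree from the
root to `j`. -/
def IsAncestorOrSelf (i j : ι) : Prop :=
  ∃ p : D.tree.Walk D.root j, p.IsPath ∧ i ∈ p.support

/-- `i` is a (proper) ancestor of `j` in the partition tree. -/
def IsAncestor (i j : ι) : Prop :=
  D.IsAncestorOrSelf i j ∧ i ≠ j

/-- The vertex set of `dom(i)`: the union of the supernodes in the subtree rooted at `i`. -/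
def domVerts (i : ι) : Set V :=
  {v | ∃ j, D.IsAncestorOrSelf i j ∧ v ∈ D.supernode j}

/-- The domain `dom(i)`, an induced subgraph of `G`. -/
def dom (i : ι) : G.Subgraph :=
  inducedOn G (D.domVerts i)

/-- The bag of the supernode `i` in the expansion of the partition tree, as a set of supernodes:
`i` itself and all its ancestors that are adjacent to it in `G`. -/
def bag (i : ι) : Set ι :=
  {j | j = i ∨ (D.IsAncestor j i ∧ AdjSets G (D.supernode j) (D.supernode i))}

/-- The bag of the supernode `i`, as a set of vertices of `G`. -/
def bagVerts (i : ι) : Set V :=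
  {v | ∃ j ∈ D.bag i, v ∈ D.supernode j}

/-- Every vertex of a supernode is within distance `Δ` of the skeleton, inside the supernode. -/
def SupernodeRadius (w : Sym2 V → ℝ≥0) (Δ : ℝ≥0) : Prop :=
  ∀ i, ∀ v ∈ D.supernode i,
    subDistSet w (inducedOn G (D.supernode i)) v (D.skeleton i).verts ≤ Δ

/-- Every skeleton is an SSSP tree in the domain, with at most `k` leaves. -/
def ShortestPathSkeleton (w : Sym2 V → ℝ≥0) (k : ℕ) : Prop :=
  ∀ i, IsSSSPTree w (D.dom i) (D.skeleton i) ∧ (leaves (D.skeleton i)).encard ≤ k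

/-- If `X` is an ancestor of `i`, then `i` and `X` are adjacent, or every vertex of `dom(i)` is at
distance at least `γ` from `X` in `dom(X)`. -/
def SupernodeBuffer (w : Sym2 V → ℝ≥0) (γ : ℝ≥0) : Prop :=
  ∀ i X, D.IsAncestor X i →
    AdjSets G (D.supernode i) (D.supernode X) ∨
      ∀ v ∈ D.domVerts i, (γ : ℝ≥0∞) ≤ subDistSet w (D.dom X) v (D.supernode X)

/-- The expansion (the partition tree with the bags above) is a tree decomposition of `G`, and
every bag consists of at most `k` supernodes. -/
def TreeDecompositionProperty (k : ℕ) : Prop :=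
  IsTreeDecomposition G D.tree D.bagVerts ∧ ∀ i, (D.bag i).encard ≤ k

/-- `D` is a `(Δ, γ, k)`-buffered cop decomposition: radius `Δ`, buffer `γ`, width `k`. -/
structure IsBuffered (w : Sym2 V → ℝ≥0) (Δ γ : ℝ≥0) (k : ℕ) : Prop where
  radius : D.SupernodeRadius w Δ
  skeleton : D.ShortestPathSkeleton w k
  buffer : D.SupernodeBuffer w γ
  treeDecomposition : D.TreeDecompositionProperty k

end CopDecomposition

end BufferedCop

/-! The supernodes are built greedily. A state assigns some vertices to supernodes, and each
component `C` of the unassigned vertices has a chain of ancestor supernodes. Every ancestor `X` of a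
supernode must either be adjacent to it or be `Buffered`, at distance at least `γ = Δ / r`, from its
whole domain. Since buffering excludes adjacency, the ancestors adjacent to `C` are pairwise
adjacent: if `X` were not adjacent to a later `Y`, it would be buffered from the domain of `Y`,
which contains `C`. Together with `C` they form a clique model, so there are at most `r - 2` of
them.

If `C` is buffered from every ancestor not adjacent to it, a new supernode is started
(`Valid.exists_new_supernode`). Its skeleton is a shortest path tree in `C` reaching one neighbour
of each adjacent ancestor; it has at most `(r - 2) + 1` leaves. If some ancestor `X` is neither
adjacent to `C` nor buffered from it, the vertices of `C` at distance less than `γ` from the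
boundary of `C` in the domain of `X` join the supernodes of their nearest boundary vertices
(`Valid.exists_grow_buffer`), and the rest of `C` becomes buffered from `X`.

The radius is controlled by charging. A growth lengthens walks to the skeleton by less than `γ`, and
is charged to a pair: the growing supernode and the ancestor `X`, which is adjacent to it and is
newly buffered. A supernode has at most `r - 2` adjacent ancestors, a set that never changes
(`Extends.adjAncestors_eq`), so all radii stay below `γ * r`. Both operations enlarge the assigned
set, so a valid state with maximal assigned set covers the graph. -/

namespace BufferedCop

/-! ### Walks -/

section Walks

variable {V : Type*} {G : SimpleGraph V} (w : Sym2 V → ℝ≥0)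

@[simp]
theorem walkLength_nil (a : V) : walkLength w (SimpleGraph.Walk.nil : G.Walk a a) = 0 := by
  simp [walkLength]

@[simp]
theorem walkLength_cons {a b c : V} (h : G.Adj a b) (p : G.Walk b c) :
    walkLength w (SimpleGraph.Walk.cons h p) = w s(a, b) + walkLength w p := by
  simp [walkLength]

@[simp]
theorem walkLength_append {a b c : V} (p : G.Walk a b) (q : G.Walk b c) :
    walkLength w (p.append q) = walkLength w p + walkLength w q := by
  simp [walkLength]

@[simp]
theorem walkLength_reverse {a b : V} (p : G.Walk a b) :
    walkLength w p.reverse = walkLength w p := by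
  simp [walkLength, List.sum_reverse]

theorem walkLength_dropUntil_le [DecidableEq V] {a b c : V} (p : G.Walk a b)
    (h : c ∈ p.support) : walkLength w (p.dropUntil c h) ≤ walkLength w p := by
  conv_rhs => rw [← p.take_spec h, walkLength_append]
  exact le_add_self

theorem walkLength_bypass_le [DecidableEq V] {a b : V} (p : G.Walk a b) :
    walkLength w p.bypass ≤ walkLength w p := by
  induction p with
  | nil => simp [SimpleGraph.Walk.bypass]
  | cons h p ih =>
    rw [SimpleGraph.Walk.bypass]
    split_ifs with hs
    · exact (walkLength_dropUntil_le w _ hs).trans (ih.trans (by simp))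
    · simpa using ih

/-- Among the walks from `u` to `S` inside `D`, there is a shortest one. -/
theorem exists_shortest_walk [Finite V] (D S : Set V) (u : V)
    (h : ∃ s ∈ S, ∃ q : G.Walk u s, ∀ x ∈ q.support, x ∈ D) :
    ∃ s ∈ S, ∃ q : G.Walk u s, (∀ x ∈ q.support, x ∈ D) ∧
      ∀ s' ∈ S, ∀ q' : G.Walk u s', (∀ x ∈ q'.support, x ∈ D) →
        walkLength w q ≤ walkLength w q' := by
  classical
  have := Fintype.ofFinite V
  let P : Set (Σ s : V, G.Path u s) := {q | q.1 ∈ S ∧ ∀ x ∈ q.2.1.support, x ∈ D}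
  have key : ∀ s ∈ S, ∀ q : G.Walk u s, (∀ x ∈ q.support, x ∈ D) →
      (⟨s, q.toPath⟩ : Σ s : V, G.Path u s) ∈ P := fun s hs q hq ↦
    ⟨hs, fun x hx ↦ hq x (q.support_bypass_subset_support hx)⟩
  have hne : P.Nonempty := by
    obtain ⟨s, hs, q, hq⟩ := h
    exact ⟨_, key s hs q hq⟩
  obtain ⟨⟨s, q⟩, hq, hmin⟩ := Set.exists_min_image P (fun q ↦ walkLength w q.2.1)
    (Set.toFinite P) hne
  exact ⟨s, hq.1, q.1, hq.2, fun s' hs' q' hq' ↦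
    (hmin _ (key s' hs' q' hq')).trans (walkLength_bypass_le w q')⟩

/-- A walk leaving `C` has an initial segment that ends with its first vertex outside `C`. -/
theorem exists_first_exit {C : Set V} {a b : V} (q : G.Walk a b) (ha : a ∈ C) (hb : b ∉ C) :
    ∃ b' ∉ C, b' ∈ q.support ∧ (∃ y ∈ C, G.Adj y b') ∧
      ∃ q' : G.Walk a b', (∀ x ∈ q'.support, x ∈ C ∪ {b'}) ∧
        walkLength w q' ≤ walkLength w q := by
  induction q with
  | nil => exact absurd ha hb
  | @cons a c b h p ih =>
    by_cases hc : c ∈ C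
    · obtain ⟨b', hb', hs, hy, q', hq', hl⟩ := ih hc hb
      refine ⟨b', hb', by simp [hs], hy, .cons h q', ?_, by simpa using hl⟩
      intro x hx
      rw [SimpleGraph.Walk.support_cons, List.mem_cons] at hx
      rcases hx with rfl | hx
      · exact Or.inl ha
      · exact hq' x hx
    · refine ⟨c, hc, by simp, ⟨a, ha, h⟩, .cons h .nil, ?_, by simp⟩
      intro x hx
      simp only [SimpleGraph.Walk.support_cons, SimpleGraph.Walk.support_nil, List.mem_cons,
        List.not_mem_nil, or_false] at hx
      rcases hx with rfl | rfl
      · exact Or.inl ha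
      · exact Or.inr rfl

/-- Any two vertices of `S` are joined by a walk inside `S`. -/
def Linked (G : SimpleGraph V) (S : Set V) : Prop :=
  ∀ a ∈ S, ∀ b ∈ S, ∃ q : G.Walk a b, ∀ x ∈ q.support, x ∈ S

theorem Linked.induce_connected {S : Set V} (h : Linked G S) (hS : S.Nonempty) :
    (G.induce S).Connected := by
  obtain ⟨a, ha⟩ := hS
  rw [SimpleGraph.connected_iff_exists_forall_reachable]
  refine ⟨⟨a, ha⟩, fun ⟨b, hb⟩ ↦ ?_⟩
  obtain ⟨q, hq⟩ := h a ha b hb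
  exact ⟨q.induce S hq⟩

theorem walk_forall {P : V → Prop} {a b : V} (q : G.Walk a b)
    (h : ∀ x ∈ q.support, ∀ y ∈ q.support, G.Adj x y → P x → P y) (ha : P a) :
    ∀ x ∈ q.support, P x := by
  induction q with
  | nil => simpa using ha
  | cons e p ih =>
    intro x hx
    rw [SimpleGraph.Walk.support_cons, List.mem_cons] at hx
    rcases hx with rfl | hx
    · exact ha
    · exact ih (fun x hx y hy ↦ h x (by simp [hx]) y (by simp [hy]))
        (h _ (by simp) _ (by simp) e ha) x hx

theorem Linked.forall {S : Set V} (h : Linked G S) {P : V → Prop}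
    (hP : ∀ x ∈ S, ∀ y ∈ S, G.Adj x y → P x → P y) {a : V} (ha : a ∈ S) (hPa : P a) :
    ∀ b ∈ S, P b := by
  intro b hb
  obtain ⟨q, hq⟩ := h a ha b hb
  exact walk_forall q (fun x hx y hy ↦ hP x (hq x hx) y (hq y hy)) hPa b q.end_mem_support

/-- The set of vertices that can be reached from `a` inside `S` is linked. -/
theorem exists_linked_component (S : Set V) (a : V) (ha : a ∈ S) :
    ∃ C ⊆ S, a ∈ C ∧ Linked G C ∧ ∀ x ∈ C, ∀ y ∈ S, G.Adj x y → y ∈ C := by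
  classical
  refine ⟨{x | ∃ q : G.Walk a x, ∀ y ∈ q.support, y ∈ S}, ?_, ⟨.nil, by simpa using ha⟩, ?_, ?_⟩
  · rintro x ⟨q, hq⟩
    exact hq x q.end_mem_support
  · rintro x ⟨q, hq⟩ y ⟨q', hq'⟩
    refine ⟨q.reverse.append q', fun z hz ↦ ?_⟩
    rw [SimpleGraph.Walk.mem_support_append_iff, SimpleGraph.Walk.support_reverse,
      List.mem_reverse] at hz
    rcases hz with hz | hz
    · exact ⟨q.takeUntil z hz, fun t ht ↦ hq t (q.support_takeUntil_subset_support hz ht)⟩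
    · exact ⟨q'.takeUntil z hz, fun t ht ↦ hq' t (q'.support_takeUntil_subset_support hz ht)⟩
  · rintro x ⟨q, hq⟩ y hy h
    refine ⟨q.concat h, fun z hz ↦ ?_⟩
    rw [SimpleGraph.Walk.support_concat, List.mem_append,
      List.mem_singleton] at hz
    rcases hz with hz | rfl
    · exact hq z hz
    · exact hy

theorem toSubgraph_le_inducedOn_iff {S : Set V} {a b : V} (p : G.Walk a b) :
    p.toSubgraph ≤ inducedOn G S ↔ ∀ x ∈ p.support, x ∈ S := by
  constructor
  · intro h x hx
    exact h.1 (p.mem_verts_toSubgraph.2 hx)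
  · intro h
    refine p.toSubgraph_le_induce_support.trans ?_
    exact SimpleGraph.Subgraph.induce_mono_right (fun x hx ↦ h x hx)

end Walks

/-! ### Trees given by parent functions -/

section ParentTrees

/-- The values of `ρ` may lie in an order that is not well-founded, such as real distances;
finiteness of `ι` suffices. -/
theorem rank_induction {ι α : Type*} [Finite ι] [Preorder α] (ρ : ι → α) {P : ι → Prop}
    (h : ∀ i, (∀ j, ρ j < ρ i → P j) → P i) (i : ι) : P i :=
  (Finite.wellFounded_of_trans_of_irrefl (fun a b : ι ↦ ρ a < ρ b)).induction i h

/-- Following the parent function `p` from the vertices of `N` until leaving `N`. -/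
theorem exists_root_map {ι α : Type*} [Finite ι] [Preorder α] (ρ : ι → α) (N : Set ι)
    (p : ι → ι) (hp : ∀ i ∈ N, ρ (p i) < ρ i) :
    ∃ F : ι → ι, (∀ i ∉ N, F i = i) ∧ ∀ i ∈ N, F i = F (p i) := by
  classical
  have wf := Finite.wellFounded_of_trans_of_irrefl (fun a b : ι ↦ ρ a < ρ b)
  refine ⟨wf.fix fun i ih ↦ if h : i ∈ N then ih (p i) (hp i h) else i, fun i hi ↦ ?_,
    fun i hi ↦ ?_⟩
  · rw [wf.fix_eq, dif_neg hi]
  · rw [wf.fix_eq, dif_pos hi]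

/-- Iterating parents reaches `r`, which gives connectedness. Acyclicity holds because each edge
from `i` to `p i` is a bridge. -/
theorem isTree_of_parent {ι α : Type*} [Finite ι] [Preorder α] (Γ : SimpleGraph ι) (r : ι)
    (p : ι → ι) (ρ : ι → α) (hp : ∀ i, i ≠ r → ρ (p i) < ρ i)
    (hadj : ∀ i j, Γ.Adj i j ↔ (i ≠ r ∧ p i = j) ∨ (j ≠ r ∧ p j = i)) : Γ.IsTree := by
  have hreach : ∀ i, Γ.Reachable r i := by
    intro i
    induction i using rank_induction ρ with
    | h i ih =>
      by_cases hi : i = r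
      · rw [hi]
      · exact (ih _ (hp i hi)).trans ((hadj _ _).2 (Or.inr ⟨hi, rfl⟩)).reachable
  refine ⟨(SimpleGraph.connected_iff_exists_forall_reachable _).2 ⟨r, hreach⟩, ?_⟩
  rw [SimpleGraph.isAcyclic_iff_forall_adj_isBridge]
  have key : ∀ i, i ≠ r → ¬ (Γ.deleteEdges {s(i, p i)}).Reachable i (p i) := by
    rintro i hi ⟨q⟩
    -- A walk from `i` that avoids the edge to `p i` stays among the descendants of `i`; reaching `p
    -- i` would make `i` an ancestor of its own parent.
    have hdesc := walk_forall (P := fun x ↦ Relation.ReflTransGen (fun a b ↦ a ≠ r ∧ p a = b) x i) q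
      (by
        intro x _ y _ hxy hx
        rw [SimpleGraph.deleteEdges_adj, hadj] at hxy
        obtain ⟨hxy | hxy, hne⟩ := hxy
        · rcases hx.cases_head with rfl | ⟨z, hz, hzi⟩
          · exact absurd (by simp [hxy.2]) hne
          · rwa [← hxy.2, hz.2]
        · exact hx.head hxy)
      Relation.ReflTransGen.refl (p i) q.end_mem_support
    have hle : ∀ a b, Relation.ReflTransGen (fun a b ↦ a ≠ r ∧ p a = b) a b → ρ b ≤ ρ a := by
      intro a b hab
      induction hab with
      | refl => exact le_rfl
      | tail _ h ih => exact (h.2 ▸ (hp _ h.1).le).trans ih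
    exact absurd (hle _ _ hdesc) (not_le_of_gt (hp i hi))
  intro a b hab
  rw [SimpleGraph.isBridge_iff]
  rcases (hadj a b).1 hab with ⟨ha, rfl⟩ | ⟨hb, rfl⟩
  · exact key a ha
  · rw [Sym2.eq_swap]
    exact fun h ↦ key b hb h.symm

end ParentTrees

/-! ### Shortest path forests and trees -/

section ShortestPaths

variable {V : Type*} {G : SimpleGraph V} (w : Sym2 V → ℝ≥0)

/-- Distances `d` and parents `p` in a shortest path forest with source set `S` inside
`K ∪ S`. -/
theorem exists_shortest_forest [Finite V] (K S : Set V) :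
    ∃ (d : V → ℝ≥0) (p : V → V), (∀ s ∈ S, d s = 0) ∧ (∀ s ∈ S, p s = s) ∧
      ∀ u, u ∉ S → (∃ s ∈ S, ∃ q : G.Walk u s, ∀ x ∈ q.support, x ∈ K ∪ S) →
        G.Adj u (p u) ∧ p u ∈ K ∪ S ∧ d u = w s(u, p u) + d (p u) ∧
        (∀ s ∈ S, ∀ q : G.Walk u s, (∀ x ∈ q.support, x ∈ K ∪ S) → d u ≤ walkLength w q) ∧
        ∃ s ∈ S, ∃ q : G.Walk (p u) s, ∀ x ∈ q.support, x ∈ K ∪ S := by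
  classical
  let d : V → ℝ≥0 := fun u ↦
    sInf {l | ∃ s ∈ S, ∃ q : G.Walk u s, (∀ x ∈ q.support, x ∈ K ∪ S) ∧ walkLength w q = l}
  have hd_le : ∀ u, ∀ s ∈ S, ∀ q : G.Walk u s, (∀ x ∈ q.support, x ∈ K ∪ S) →
      d u ≤ walkLength w q := fun u s hs q hq ↦
    csInf_le (OrderBot.bddBelow _) ⟨s, hs, q, hq, rfl⟩
  have hd : ∀ u, (∃ s ∈ S, ∃ q : G.Walk u s, ∀ x ∈ q.support, x ∈ K ∪ S) →
      ∃ s ∈ S, ∃ q : G.Walk u s, (∀ x ∈ q.support, x ∈ K ∪ S) ∧ walkLength w q = d u := by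
    intro u hu
    obtain ⟨s, hs, q, hq, hmin⟩ := exists_shortest_walk w (K ∪ S) S u hu
    refine ⟨s, hs, q, hq, le_antisymm (le_csInf ⟨_, s, hs, q, hq, rfl⟩ ?_) (hd_le u s hs q hq)⟩
    rintro _ ⟨s', hs', q', hq', rfl⟩
    exact hmin s' hs' q' hq'
  have hpar : ∀ u, ∃ v, (u ∈ S → v = u) ∧
      (u ∉ S → (∃ s ∈ S, ∃ q : G.Walk u s, ∀ x ∈ q.support, x ∈ K ∪ S) →
        G.Adj u v ∧ v ∈ K ∪ S ∧ d u = w s(u, v) + d v ∧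
        ∃ s ∈ S, ∃ q : G.Walk v s, ∀ x ∈ q.support, x ∈ K ∪ S) := by
    intro u
    by_cases hu : u ∈ S
    · exact ⟨u, fun _ ↦ rfl, fun h ↦ absurd hu h⟩
    by_cases hq : ∃ s ∈ S, ∃ q : G.Walk u s, ∀ x ∈ q.support, x ∈ K ∪ S
    swap
    · exact ⟨u, fun _ ↦ rfl, fun _ h ↦ absurd h hq⟩
    obtain ⟨s, hs, q, hqs, hlen⟩ := hd u hq
    cases q with
    | nil => exact absurd hs hu
    | @cons _ v _ h q =>
      have hqs' : ∀ x ∈ q.support, x ∈ K ∪ S := fun x hx ↦ hqs x (by simp [hx])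
      refine ⟨v, fun h ↦ absurd h hu, fun _ _ ↦ ⟨h, hqs' v q.start_mem_support, ?_,
        s, hs, q, hqs'⟩⟩
      apply le_antisymm
      · obtain ⟨s', hs', q', hq', hlen'⟩ := hd v ⟨s, hs, q, hqs'⟩
        rw [← hlen', ← walkLength_cons w h]
        refine hd_le u s' hs' _ fun x hx ↦ ?_
        rw [SimpleGraph.Walk.support_cons, List.mem_cons] at hx
        rcases hx with rfl | hx
        · exact hqs x (by simp)
        · exact hq' x hx
      · rw [← hlen, walkLength_cons]
        exact add_le_add le_rfl (hd_le v s hs q hqs')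
  choose p hp using hpar
  refine ⟨d, p, fun s hs ↦ ?_, fun s hs ↦ (hp s).1 hs, fun u hu hq ↦ ?_⟩
  · simpa using hd_le s s hs .nil (by simp [hs])
  · obtain ⟨h1, h2, h3, h4⟩ := (hp u).2 hu hq
    exact ⟨h1, h2, h3, fun s hs q ↦ hd_le u s hs q, h4⟩

/-- `T` is a tree inside `D` that has at most `k` leaves and contains a shortest path of `G[D]`
from some source to each of its vertices. -/
structure IsSkeleton (T : G.Subgraph) (D : Set V) (k : ℕ) : Prop where
  isTree : T.coe.IsTree
  subset : T.verts ⊆ D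
  shortest : ∃ s ∈ T.verts, ∀ v ∈ T.verts, ∀ q : G.Walk s v, (∀ x ∈ q.support, x ∈ D) →
    ∃ q' : G.Walk s v, q'.toSubgraph ≤ T ∧ walkLength w q' ≤ walkLength w q
  leaves_le : (leaves T).encard ≤ k

variable {w}

theorem IsSkeleton.mono {T : G.Subgraph} {D D' : Set V} {k : ℕ} (h : IsSkeleton w T D k)
    (hT : T.verts ⊆ D') (hD : D' ⊆ D) : IsSkeleton w T D' k where
  isTree := h.isTree
  subset := hT
  shortest := by
    obtain ⟨s, hs, H⟩ := h.shortest
    exact ⟨s, hs, fun v hv q hq ↦ H v hv q fun x hx ↦ hD (hq x hx)⟩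
  leaves_le := h.leaves_le

theorem IsSkeleton.nonempty {T : G.Subgraph} {D : Set V} {k : ℕ} (h : IsSkeleton w T D k) :
    T.verts.Nonempty := by
  obtain ⟨x⟩ := h.isTree.1.nonempty
  exact ⟨x, x.2⟩

theorem le_inducedOn {T : G.Subgraph} {D : Set V} (h : T.verts ⊆ D) : T ≤ inducedOn G D :=
  ⟨h, fun _ _ hab ↦ ⟨h (T.edge_vert hab), h (T.edge_vert hab.symm), T.adj_sub hab⟩⟩

theorem IsSkeleton.isSSSPTree {T : G.Subgraph} {D : Set V} {k : ℕ} (h : IsSkeleton w T D k) :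
    IsSSSPTree w (inducedOn G D) T := by
  refine ⟨h.isTree, le_inducedOn h.subset, ?_⟩
  obtain ⟨s, hs, H⟩ := h.shortest
  refine ⟨s, hs, fun v hv ↦ le_antisymm ?_ ?_⟩
  · refine le_iInf₂ fun q hq ↦ ?_
    obtain ⟨q', hq', hl⟩ := H v hv q ((toSubgraph_le_inducedOn_iff q).1 hq)
    exact (iInf₂_le q' hq').trans (by exact_mod_cast hl)
  · exact le_iInf₂ fun q hq ↦ iInf₂_le q (hq.trans (le_inducedOn h.subset))

theorem linked_verts_of_isTree {T : G.Subgraph} (h : T.coe.IsTree) : Linked G T.verts := by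
  intro a ha b hb
  obtain ⟨q⟩ := h.1.preconnected ⟨a, ha⟩ ⟨b, hb⟩
  refine ⟨q.map T.hom, fun x hx ↦ ?_⟩
  have hx' := (SimpleGraph.Walk.support_map (f := T.hom) q) ▸ hx
  obtain ⟨y, -, rfl⟩ := List.mem_map.1 hx'
  exact y.2

/-- In a linked set `C` there is a shortest path tree that contains a given source `s` and a given
set `U`, all of whose leaves are in `U ∪ {s}`. -/
theorem exists_isSkeleton [Finite V] (hw : ∀ e ∈ G.edgeSet, 0 < w e) {C : Set V} (hC : Linked G C)
    {s : V} (hs : s ∈ C) {U : Set V} (hU : U ⊆ C) :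
    ∃ T : G.Subgraph, s ∈ T.verts ∧ U ⊆ T.verts ∧ IsSkeleton w T C (U.ncard + 1) := by
  classical
  obtain ⟨d, p, hd0, hp0, hdp⟩ := exists_shortest_forest (G := G) w C {s}
  have hCs : C ∪ {s} = C := by simpa using hs
  simp only [hCs, Set.mem_singleton_iff, exists_eq_left, forall_eq] at hd0 hp0 hdp
  have hdp' := fun u (hu : u ∈ C) (hus : u ≠ s) ↦ hdp u hus (hC u hu s hs)
  have hlt : ∀ u ∈ C, u ≠ s → d (p u) < d u := fun u hu hus ↦ by
    obtain ⟨h1, -, h3, -⟩ := hdp' u hu hus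
    rw [h3]
    exact lt_add_of_pos_left _ (hw _ h1)
  have hpC : ∀ u ∈ C, p u ∈ C := fun u hu ↦ by
    by_cases hus : u = s
    · rwa [hus, hp0]
    · exact (hdp' u hu hus).2.1
  -- The tree is the union of the parent chains issuing from `U` and `s`.
  let W : Set V := {v | ∃ u ∈ insert s U, ∃ n : ℕ, p^[n] u = v}
  have hWp : ∀ v ∈ W, p v ∈ W := by
    rintro _ ⟨u, hu, n, rfl⟩
    exact ⟨u, hu, n + 1, Function.iterate_succ_apply' p n u⟩
  have hWC : W ⊆ C := by
    rintro _ ⟨u, hu, n, rfl⟩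
    have huC : u ∈ C := by
      rcases hu with rfl | hu
      · exact hs
      · exact hU hu
    induction n with
    | zero => exact huC
    | succ n ih => rw [Function.iterate_succ_apply']; exact hpC _ ih
  have hsW : s ∈ W := ⟨s, Set.mem_insert _ _, 0, rfl⟩
  let T : G.Subgraph :=
    { verts := W
      Adj := fun a b ↦ a ∈ W ∧ b ∈ W ∧ ((a ≠ s ∧ p a = b) ∨ (b ≠ s ∧ p b = a))
      adj_sub := by
        rintro a b ⟨ha, hb, ⟨hne, rfl⟩ | ⟨hne, rfl⟩⟩
        · exact (hdp' a (hWC ha) hne).1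
        · exact (hdp' b (hWC hb) hne).1.symm
      edge_vert := fun h ↦ h.1
      symm := ⟨fun a b h ↦ ⟨h.2.1, h.1, h.2.2.symm⟩⟩ }
  have hwalk : ∀ v, v ∈ W → ∃ q : G.Walk v s, q.toSubgraph ≤ T ∧ walkLength w q = d v := by
    intro v
    induction v using rank_induction d with
    | h v ih =>
      intro hv
      by_cases hvs : v = s
      · subst hvs
        refine ⟨.nil, ?_, by simp [hd0]⟩
        rw [SimpleGraph.Walk.toSubgraph, SimpleGraph.singletonSubgraph_le_iff]
        exact hv
      · obtain ⟨h1, -, h3, -⟩ := hdp' v (hWC hv) hvs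
        obtain ⟨q, hq, hl⟩ := ih _ (hlt v (hWC hv) hvs) (hWp v hv)
        refine ⟨.cons h1 q, ?_, by rw [walkLength_cons, hl, h3]⟩
        rw [SimpleGraph.Walk.toSubgraph]
        refine sup_le (SimpleGraph.subgraphOfAdj_le_of_adj _ ?_) hq
        exact ⟨hv, hWp v hv, Or.inl ⟨hvs, rfl⟩⟩
  refine ⟨T, hsW, fun u hu ↦ ⟨u, Set.mem_insert_of_mem _ hu, 0, rfl⟩, ?_, hWC, ?_, ?_⟩
  · refine isTree_of_parent T.coe ⟨s, hsW⟩ (fun v ↦ ⟨p v, hWp v v.2⟩) (fun v ↦ d v) ?_ ?_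
    · rintro ⟨v, hv⟩ hvs
      exact hlt v (hWC hv) fun h ↦ hvs (Subtype.ext h)
    · rintro ⟨a, ha⟩ ⟨b, hb⟩
      have ha' : a ∈ W := ha
      have hb' : b ∈ W := hb
      simp [T, ha', hb']
  · refine ⟨s, hsW, fun v hv q hq ↦ ?_⟩
    obtain ⟨q', hq', hl⟩ := hwalk v hv
    refine ⟨q'.reverse, by simpa using hq', ?_⟩
    rw [walkLength_reverse, hl]
    by_cases hvs : v = s
    · subst hvs
      rw [hd0]
      exact zero_le
    · rw [← walkLength_reverse w q]
      exact (hdp' v (hWC hv) hvs).2.2.2.1 _ (by simpa using hq)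
  · have hsub : leaves T ⊆ insert s U := by
      rintro v ⟨⟨u, hu, n, rfl⟩, hdeg⟩
      by_contra hv
      rw [Set.mem_insert_iff, not_or] at hv
      cases n with
      | zero => exact absurd hu (by simpa using hv)
      | succ n =>
        set y := p^[n] u with hy
        have hyW : y ∈ W := ⟨u, hu, n, rfl⟩
        rw [Function.iterate_succ_apply', ← hy] at hv hdeg
        have hys : y ≠ s := fun h ↦ hv.1 (by rw [h, hp0])
        have hpy := hWp y hyW
        have e1 : y ∈ T.neighborSet (p y) := ⟨hpy, hyW, Or.inr ⟨hys, rfl⟩⟩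
        have e2 : p (p y) ∈ T.neighborSet (p y) := ⟨hpy, hWp _ hpy, Or.inl ⟨hv.1, rfl⟩⟩
        have := Set.encard_le_one_iff.1 hdeg _ _ e1 e2
        have hlt' := (hlt _ (hWC hpy) hv.1).trans (hlt y (hWC hyW) hys)
        rw [← this] at hlt'
        exact lt_irrefl _ hlt'
    refine (Set.encard_le_encard hsub).trans ((Set.encard_insert_le _ _).trans ?_)
    rw [← (Set.toFinite U).cast_ncard_eq]
    exact le_rfl

end ShortestPaths

/-! ### Clique minors -/

theorem card_lt_of_cliqueMinorFree {V : Type*} {G : SimpleGraph V} {r : ℕ}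
    (hG : CliqueMinorFree G r) {κ : Type*} [Fintype κ] (B : κ → Set V)
    (hne : ∀ a, (B a).Nonempty) (hlink : ∀ a, Linked G (B a))
    (hdisj : ∀ a b, a ≠ b → Disjoint (B a) (B b))
    (hadj : ∀ a b, a ≠ b → AdjSets G (B a) (B b)) : Fintype.card κ < r := by
  by_contra! h
  obtain ⟨f⟩ : Nonempty (Fin r ↪ κ) := Function.Embedding.nonempty_of_card_le (by simpa using h)
  refine hG ⟨fun i ↦ B (f i), fun i ↦ (hlink _).induce_connected (hne _),
    fun i j hij ↦ hdisj _ _ (f.injective.ne hij), fun i j hij ↦ ?_⟩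
  exact hadj _ _ (f.injective.ne (by simpa [SimpleGraph.completeGraph] using hij))

/-! ### Partial decompositions -/

section States

variable {V : Type*} {G : SimpleGraph V}

/-- A partial buffered cop decomposition. A supernode is labelled by the list of the sources of
its ancestors, its own source first, so that `X` is an ancestor of `l` iff `X` is a suffix of `l`.
The label `loc v` of a vertex that is not yet assigned to a supernode is the deepest supernode
whose domain contains `v`. -/
structure PartialDecomposition (G : SimpleGraph V) where
  /-- the vertices that are already assigned to a supernode -/
  assigned : Set V
  /-- the label of a vertex -/
  loc : V → List V
  /-- the skeleton of the supernode with a given label -/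
  skel : List V → G.Subgraph

namespace PartialDecomposition

variable (w : Sym2 V → ℝ≥0) (γ : ℝ≥0) (S S' : PartialDecomposition G)

/-- The supernode with label `l`. -/
def cell (l : List V) : Set V := {v | v ∈ S.assigned ∧ S.loc v = l}

/-- The domain of the supernode with label `l`. -/
def dom (l : List V) : Set V := {v | l <:+ S.loc v}

/-- The proper ancestors of `l` that are adjacent to `l`. -/
def adjAncestors (l : List V) : Set (List V) :=
  {X | X ≠ [] ∧ X <:+ l ∧ X ≠ l ∧ AdjSets G (S.cell X) (S.cell l)}

/-- A certificate, stable under extending the decomposition, that `u` and all vertices that will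
be separated from `X` together with `u` are at distance at least `γ` from `X` in the domain
of `X`. -/
def Buffered (X : List V) (u : V) : Prop :=
  -- `R` keeps `X` away even if `X` gains vertices later, and `K` is the part of `R` deep enough to
  -- be at distance `γ` from the complement of `R`. Both can be left only through assigned vertices,
  -- so each contains every unassigned component that it meets.
  ∃ R K : Set V, u ∈ K ∧ K ⊆ R ∧
    (∀ x ∈ R, ∀ y ∉ R, G.Adj x y → y ∈ S.assigned) ∧
    (∀ x ∈ K, ∀ y ∉ K, G.Adj x y → y ∈ S.assigned) ∧
    (∀ x ∈ S.cell X, x ∉ R ∧ ∀ y ∈ R, ¬ G.Adj x y) ∧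
    ∀ a ∈ K, ∀ b ∉ R, ∀ q : G.Walk a b, (∀ x ∈ q.support, x ∈ S.dom X) → γ ≤ walkLength w q

/-- There is a walk of length at most `ρ` from `v` to the skeleton inside the supernode of `v`. -/
def RadiusLE (v : V) (ρ : ℝ≥0) : Prop :=
  ∃ t ∈ (S.skel (S.loc v)).verts, ∃ q : G.Walk v t,
    (∀ x ∈ q.support, x ∈ S.cell (S.loc v)) ∧ walkLength w q ≤ ρ

/-- `C` is a connected component of the unassigned vertices. -/
structure IsComponent (C : Set V) : Prop where
  nonempty : C.Nonempty
  unassigned : ∀ x ∈ C, x ∉ S.assigned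
  linked : Linked G C
  closed : ∀ x ∈ C, ∀ y ∉ S.assigned, G.Adj x y → y ∈ C

/-- The invariants of the construction. -/
structure Valid (r : ℕ) : Prop where
  source : ∀ v s k, s :: k <:+ S.loc v → s ∈ S.assigned ∧ S.loc s = s :: k
  root : ∃ v₀, ∀ v, [v₀] <:+ S.loc v
  loc_suffix : ∀ u ∉ S.assigned, ∀ v, G.Adj u v → S.loc v <:+ S.loc u
  comparable : ∀ u ∈ S.assigned, ∀ v ∈ S.assigned, G.Adj u v →
    S.loc u <:+ S.loc v ∨ S.loc v <:+ S.loc u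
  isSkeleton : ∀ v ∈ S.assigned, IsSkeleton w (S.skel (S.loc v)) (S.dom (S.loc v)) (r - 1)
  skel_subset : ∀ v ∈ S.assigned, (S.skel (S.loc v)).verts ⊆ S.cell (S.loc v)
  buffer : ∀ v ∈ S.assigned, ∀ X, X ≠ [] → X <:+ S.loc v → X ≠ S.loc v →
    AdjSets G (S.cell X) (S.cell (S.loc v)) ∨ ∀ u ∈ S.dom (S.loc v), S.Buffered w γ X u
  ncard_le : ∀ v ∈ S.assigned, (S.adjAncestors (S.loc v)).ncard + 2 ≤ r
  radius : ∀ v ∈ S.assigned, S.RadiusLE w v (γ * r)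
  -- This is the charging scheme: a supernode that can still grow near `u` has used at most one `γ`
  -- per adjacent ancestor already buffered from `u`.
  boundary_radius : ∀ b ∈ S.assigned, ∀ u ∉ S.assigned, G.Adj b u →
    S.RadiusLE w b (γ * {X ∈ S.adjAncestors (S.loc b) | S.Buffered w γ X u}.ncard)

/-- `S'` arises from `S` by assigning vertices of the component `C`. -/
structure Extends (C : Set V) : Prop where
  isComponent : S.IsComponent C
  subset : S.assigned ⊆ S'.assigned
  mem_of_new : ∀ v ∈ S'.assigned, v ∉ S.assigned → v ∈ C
  loc_eq : ∀ v ∈ S.assigned, S'.loc v = S.loc v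
  dom_subset : ∀ v ∈ S.assigned, S'.dom (S.loc v) ⊆ S.dom (S.loc v)
  -- An old supernode grows only into a component that it already touches. This keeps it out of the
  -- sets `R` that certify buffers.
  adj_of_new : ∀ v ∈ S'.assigned, v ∉ S.assigned → ∀ u ∈ S.assigned, S'.loc v = S.loc u →
    AdjSets G (S.cell (S.loc u)) C
  skel_eq : ∀ v ∈ S.assigned, S'.skel (S.loc v) = S.skel (S.loc v)

variable {w γ S S'} {r : ℕ} {C : Set V}

/-! ### Consequences of the invariants -/

theorem finite_adjAncestors (l : List V) : (S.adjAncestors l).Finite := by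
  classical
  refine (l.tails.toFinset.finite_toSet).subset fun X hX ↦ ?_
  simpa using hX.2.1

theorem cell_subset_dom (l : List V) : S.cell l ⊆ S.dom l := by
  rintro v ⟨-, rfl⟩
  exact List.suffix_refl _

theorem dom_mono {X l : List V} (h : X <:+ l) : S.dom l ⊆ S.dom X :=
  fun _ hv ↦ h.trans hv

theorem mem_cell {v : V} (hv : v ∈ S.assigned) : v ∈ S.cell (S.loc v) := ⟨hv, rfl⟩

theorem Buffered.not_adj {X : List V} {y : V} (h : S.Buffered w γ X y) :
    ∀ x ∈ S.cell X, ¬ G.Adj x y := by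
  obtain ⟨R, K, hy, hKR, -, -, hX, -⟩ := h
  exact fun x hx ↦ (hX x hx).2 y (hKR hy)

theorem Buffered.of_mem_component {X : List V} {y u : V} (h : S.Buffered w γ X y)
    (hC : S.IsComponent C) (hy : y ∈ C) (hu : u ∈ C) : S.Buffered w γ X u := by
  obtain ⟨R, K, hyK, hKR, hR, hK, h⟩ := h
  refine ⟨R, K, ?_, hKR, hR, hK, h⟩
  refine hC.linked.forall (P := (· ∈ K)) (fun a _ b hb hab ha ↦ ?_) hy hyK u hu
  by_contra hbK
  exact hC.unassigned b hb (hK a ha b hbK hab)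

theorem Valid.exists_loc_eq (hS : S.Valid w γ r) {v : V} {X : List V} (hX : X ≠ [])
    (h : X <:+ S.loc v) : ∃ s ∈ S.assigned, S.loc s = X := by
  obtain ⟨s, k, rfl⟩ := List.exists_cons_of_ne_nil hX
  exact ⟨s, hS.source v s k h⟩

/-- By `loc_suffix`, the labels of adjacent unassigned vertices are suffixes of each other, hence
equal. -/
theorem Valid.loc_const (hS : S.Valid w γ r) (hC : S.IsComponent C) :
    ∃ k, ∀ v ∈ C, S.loc v = k := by
  obtain ⟨a, ha⟩ := hC.nonempty
  refine ⟨S.loc a, hC.linked.forall (P := fun v ↦ S.loc v = S.loc a)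
    (fun x hx y hy hxy h ↦ ?_) ha rfl⟩
  rw [← h]
  exact (hS.loc_suffix x (hC.unassigned x hx) y hxy).sublist.antisymm
    (hS.loc_suffix y (hC.unassigned y hy) x hxy.symm).sublist

theorem Valid.linked_cell (hS : S.Valid w γ r) {v : V} (hv : v ∈ S.assigned) :
    Linked G (S.cell (S.loc v)) := by
  have hT := linked_verts_of_isTree (hS.isSkeleton v hv).isTree
  rintro a ⟨ha, hav⟩ b ⟨hb, hbv⟩
  obtain ⟨s, hs, p, hp, -⟩ := hS.radius a ha
  obtain ⟨t, ht, q, hq, -⟩ := hS.radius b hb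
  rw [hav] at hs hp
  rw [hbv] at ht hq
  obtain ⟨m, hm⟩ := hT s hs t ht
  refine ⟨p.append (m.append q.reverse), fun x hx ↦ ?_⟩
  simp only [SimpleGraph.Walk.mem_support_append_iff, SimpleGraph.Walk.support_reverse,
    List.mem_reverse] at hx
  rcases hx with hx | hx | hx
  · exact hp x hx
  · exact hS.skel_subset v hv (hm x hx)
  · exact hq x hx

theorem _root_.BufferedCop.AdjSets.symm {A B : Set V} (h : AdjSets G A B) : AdjSets G B A := by
  obtain ⟨x, hx, y, hy, hxy⟩ := h
  exact ⟨y, hy, x, hx, hxy.symm⟩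

theorem _root_.BufferedCop.AdjSets.mono {A B A' B' : Set V} (h : AdjSets G A B) (hA : A ⊆ A')
    (hB : B ⊆ B') : AdjSets G A' B' := by
  obtain ⟨x, hx, y, hy, hxy⟩ := h
  exact ⟨x, hA hx, y, hB hy, hxy⟩

/-! ### Stability of the invariants under extension -/

namespace Extends

variable (hE : S.Extends S' C)
include hE

theorem cell_subset (l : List V) : S.cell l ⊆ S'.cell l := by
  rintro v ⟨hv, rfl⟩
  exact ⟨hE.subset hv, hE.loc_eq v hv⟩

/-- The same `R` and `K` remain a certificate. If a new vertex of `X` were in `R`, all of `C` would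
be in `R`, although `C` has a vertex adjacent to the old part of `X`. Shrinking domains leave fewer
walks to bound. -/
theorem buffered {s : V} (hs : s ∈ S.assigned) {u : V} (h : S.Buffered w γ (S.loc s) u) :
    S'.Buffered w γ (S.loc s) u := by
  obtain ⟨R, K, hu, hKR, hR, hK, hX, hlen⟩ := h
  refine ⟨R, K, hu, hKR, fun x hx y hy h ↦ hE.subset (hR x hx y hy h),
    fun x hx y hy h ↦ hE.subset (hK x hx y hy h), ?_,
    fun a ha b hb q hq ↦ hlen a ha b hb q fun x hx ↦ hE.dom_subset s hs (hq x hx)⟩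
  rintro x ⟨hx, hxs⟩
  by_cases hxA : x ∈ S.assigned
  · exact hX x ⟨hxA, by rw [← hE.loc_eq x hxA, hxs]⟩
  have hxC := hE.mem_of_new x hx hxA
  have hxR : x ∉ R := by
    intro hxR
    have hCR := hE.isComponent.linked.forall (P := (· ∈ R)) (fun a _ b hb hab ha ↦ by
      by_contra hbR
      exact hE.isComponent.unassigned b hb (hR a ha b hbR hab)) hxC hxR
    obtain ⟨y, hy, c, hc, hyc⟩ := hE.adj_of_new x hx hxA s hs hxs
    exact (hX y hy).2 c (hCR c hc) hyc
  exact ⟨hxR, fun y hy hxy ↦ hxA (hR y hy x hxR hxy.symm)⟩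

theorem buffer (hS : S.Valid w γ r) {v : V} (hv : v ∈ S.assigned) {X : List V} (hX : X ≠ [])
    (hXv : X <:+ S.loc v) (hne : X ≠ S.loc v) :
    AdjSets G (S'.cell X) (S'.cell (S.loc v)) ∨
      ∀ u ∈ S'.dom (S.loc v), S'.Buffered w γ X u := by
  refine (hS.buffer v hv X hX hXv hne).imp
    (fun h ↦ h.mono (hE.cell_subset _) (hE.cell_subset _)) fun h u hu ↦ ?_
  obtain ⟨s, hs, rfl⟩ := hS.exists_loc_eq hX hXv
  exact hE.buffered hs (h u (hE.dom_subset v hv hu))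

/-- An ancestor not adjacent at the start is buffered, and a buffer persists and forbids adjacency
for good. -/
theorem adjAncestors_eq (hS : S.Valid w γ r) {v : V} (hv : v ∈ S.assigned) :
    S'.adjAncestors (S.loc v) = S.adjAncestors (S.loc v) := by
  ext X
  constructor
  · rintro ⟨hX, hXv, hne, x, hx, y, hy, hxy⟩
    refine ⟨hX, hXv, hne, (hS.buffer v hv X hX hXv hne).resolve_right fun h ↦ ?_⟩
    obtain ⟨s, hs, rfl⟩ := hS.exists_loc_eq hX hXv
    exact (hE.buffered hs (h y (hE.dom_subset v hv (cell_subset_dom _ hy)))).not_adj x hx hxy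
  · rintro ⟨hX, hXv, hne, h⟩
    exact ⟨hX, hXv, hne, h.mono (hE.cell_subset _) (hE.cell_subset _)⟩

theorem skel_subset (hS : S.Valid w γ r) {v : V} (hv : v ∈ S.assigned) :
    (S'.skel (S.loc v)).verts ⊆ S'.cell (S.loc v) := by
  rw [hE.skel_eq v hv]
  exact (hS.skel_subset v hv).trans (hE.cell_subset _)

theorem isSkeleton (hS : S.Valid w γ r) {v : V} (hv : v ∈ S.assigned) :
    IsSkeleton w (S'.skel (S.loc v)) (S'.dom (S.loc v)) (r - 1) := by
  have h := (hE.skel_subset hS hv).trans (cell_subset_dom _)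
  rw [hE.skel_eq v hv] at h ⊢
  exact (hS.isSkeleton v hv).mono h (hE.dom_subset v hv)

theorem radiusLE {v : V} (hv : v ∈ S.assigned) {ρ ρ' : ℝ≥0} (h : S.RadiusLE w v ρ)
    (hρ : ρ ≤ ρ') : S'.RadiusLE w v ρ' := by
  obtain ⟨t, ht, q, hq, hl⟩ := h
  rw [RadiusLE, hE.loc_eq v hv, hE.skel_eq v hv]
  exact ⟨t, ht, q, fun x hx ↦ hE.cell_subset _ (hq x hx), hl.trans hρ⟩

theorem boundary_radius (hS : S.Valid w γ r) {b u : V} (hb : b ∈ S.assigned)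
    (hu : u ∉ S'.assigned) (hbu : G.Adj b u) :
    S'.RadiusLE w b (γ * {X ∈ S'.adjAncestors (S'.loc b) | S'.Buffered w γ X u}.ncard) := by
  refine hE.radiusLE hb (hS.boundary_radius b hb u (fun h ↦ hu (hE.subset h)) hbu) ?_
  rw [hE.loc_eq b hb, hE.adjAncestors_eq hS hb]
  refine mul_le_mul_of_nonneg_left (Nat.cast_le.2 (Set.ncard_le_ncard ?_
    ((finite_adjAncestors _).subset (Set.sep_subset _ _)))) (zero_le (a := γ))
  rintro X ⟨hX, h⟩
  obtain ⟨s, hs, rfl⟩ := hS.exists_loc_eq hX.1 hX.2.1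
  exact ⟨hX, hE.buffered hs h⟩

end Extends

end PartialDecomposition

end States

/-! ### The two extension steps and their iteration -/

section Steps

variable {V : Type*} [Finite V] {G : SimpleGraph V}

namespace PartialDecomposition

variable {w : Sym2 V → ℝ≥0} {γ : ℝ≥0} {S : PartialDecomposition G} {r : ℕ} {C : Set V}

/-! ### Growing a buffer -/

/-- If the component `C` is cut off from its ancestor `X` without being buffered from it, then the
vertices of `C` that are close to the part of the domain of `X` outside `C` can be distributed to
the supernodes between `X` and `C`. -/
theorem Valid.exists_grow_buffer (hw : ∀ e ∈ G.edgeSet, 0 < w e) (hS : S.Valid w γ r)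
    (hC : S.IsComponent C) {X k : List V} (hk : ∀ v ∈ C, S.loc v = k) (hX : X ≠ [])
    (hXk : X <:+ k) (hXC : ¬ AdjSets G (S.cell X) C) {u₀ : V} (hu₀ : u₀ ∈ C)
    (hbuf : ¬ S.Buffered w γ X u₀) :
    ∃ S' : PartialDecomposition G, S'.Valid w γ r ∧ S.assigned ⊂ S'.assigned := by
  classical
  -- Walks in the domain of `X` that leave `C` first exit through these vertices.
  let bd : Set V := {b | b ∈ S.assigned ∧ X <:+ S.loc b ∧ ∃ y ∈ C, G.Adj b y}
  have hbdC : ∀ b ∈ bd, b ∉ C := fun b hb h ↦ hC.unassigned b h hb.1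
  have hbd_le : ∀ b ∈ bd, S.loc b <:+ k := by
    rintro b ⟨-, -, y, hy, hby⟩
    exact hk y hy ▸ hS.loc_suffix y (hC.unassigned y hy) b hby.symm
  obtain ⟨d, p, hd0, -, hdp⟩ := exists_shortest_forest (G := G) w C bd
  let N : Set V := {u | u ∈ C ∧
    (∃ s ∈ bd, ∃ q : G.Walk u s, ∀ x ∈ q.support, x ∈ C ∪ bd) ∧ d u < γ}
  have hNp : ∀ u ∈ N, G.Adj u (p u) ∧ d u = w s(u, p u) + d (p u) ∧ (p u ∈ N ∨ p u ∈ bd) := by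
    rintro u ⟨huC, hreach, hlt⟩
    obtain ⟨h1, h2, h3, -, h5⟩ := hdp u (fun h ↦ hbdC u h huC) hreach
    refine ⟨h1, h3, h2.imp (fun h ↦ ⟨h, h5, lt_of_le_of_lt ?_ hlt⟩) id⟩
    rw [h3]
    exact le_add_self
  have hNlt : ∀ u ∈ N, d (p u) < d u := fun u hu ↦ by
    obtain ⟨h1, h2, -⟩ := hNp u hu
    rw [h2]
    exact lt_add_of_pos_left _ (hw _ h1)
  -- `F u` is the boundary vertex at the root of the shortest path tree of `u`; `u` will join its
  -- supernode.
  obtain ⟨F, hF, hFp⟩ := exists_root_map d N p hNlt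
  have hFbd : ∀ b ∈ bd, F b = b := fun b hb ↦ hF b fun h ↦ hbdC b hb h.1
  have hwalk : ∀ u, u ∈ N → F u ∈ bd ∧ ∃ q : G.Walk u (F u),
      (∀ x ∈ q.support, F x = F u ∧ (x ∈ N ∨ x = F u)) ∧ walkLength w q = d u := by
    intro u
    induction u using rank_induction d with
    | h u ih =>
      intro hu
      obtain ⟨h1, h2, h3 | h3⟩ := hNp u hu
      · obtain ⟨hb, q, hq, hl⟩ := ih _ (hNlt u hu) h3
        rw [hFp u hu]
        refine ⟨hb, .cons h1 q, fun x hx ↦ ?_, by rw [walkLength_cons, hl, h2]⟩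
        rw [SimpleGraph.Walk.support_cons, List.mem_cons] at hx
        rcases hx with rfl | hx
        · exact ⟨hFp _ hu, Or.inl hu⟩
        · exact hq x hx
      · rw [hFp u hu, hFbd _ h3]
        refine ⟨h3, .cons h1 .nil, fun x hx ↦ ?_, by
          rw [walkLength_cons, walkLength_nil, h2, hd0 _ h3]⟩
        simp only [SimpleGraph.Walk.support_cons, SimpleGraph.Walk.support_nil, List.mem_cons,
          List.not_mem_nil, or_false] at hx
        rcases hx with rfl | rfl
        · exact ⟨by rw [hFp _ hu, hFbd _ h3], Or.inl hu⟩
        · exact ⟨hFbd _ h3, Or.inr rfl⟩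
  let S' : PartialDecomposition G :=
    { assigned := S.assigned ∪ N
      loc := fun v ↦ if v ∈ N then S.loc (F v) else S.loc v
      skel := S.skel }
  have hlocN : ∀ v ∈ N, S'.loc v = S.loc (F v) := fun v hv ↦ if_pos hv
  have hloc : ∀ v ∉ N, S'.loc v = S.loc v := fun v hv ↦ if_neg hv
  have hlocA : ∀ v ∈ S.assigned, S'.loc v = S.loc v := fun v hv ↦
    hloc v fun h ↦ hC.unassigned v h.1 hv
  have hloc_le : ∀ v, S'.loc v <:+ S.loc v := fun v ↦ by
    by_cases hv : v ∈ N
    · rw [hlocN v hv, hk v hv.1]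
      exact hbd_le _ (hwalk v hv).1
    · rw [hloc v hv]
  have hloc_ex : ∀ v, ∃ v', S'.loc v = S.loc v' := fun v ↦ by
    by_cases hv : v ∈ N
    · exact ⟨_, hlocN v hv⟩
    · exact ⟨_, hloc v hv⟩
  have hE : S.Extends S' C :=
    { isComponent := hC
      subset := Set.subset_union_left
      mem_of_new := fun v hv hvA ↦ (hv.resolve_left hvA).1
      loc_eq := hlocA
      dom_subset := fun v _ x hx ↦ List.IsSuffix.trans hx (hloc_le x)
      adj_of_new := by
        intro v hv hvA u hu huv
        have hvN : v ∈ N := hv.resolve_left hvA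
        obtain ⟨hbA, -, y, hy, hby⟩ := (hwalk v hvN).1
        rw [hlocN v hvN] at huv
        exact ⟨F v, ⟨hbA, huv⟩, y, hy, hby⟩
      skel_eq := fun _ _ ↦ rfl }
  obtain ⟨s, hs, rfl⟩ := hS.exists_loc_eq hX (v := u₀) (by rwa [hk u₀ hu₀])
  -- vertices of `C` with a short walk in the domain of `X` leaving `C` belong to `N`
  have hexit : ∀ a ∈ C, ∀ b ∉ C, ∀ q : G.Walk a b,
      (∀ x ∈ q.support, x ∈ S.dom (S.loc s)) → walkLength w q < γ → a ∈ N := by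
    intro a ha b hb q hq hl
    obtain ⟨b', hb', hbq, ⟨y, hy, hyb⟩, q', hq', hl'⟩ := exists_first_exit w q ha hb
    have hbA : b' ∈ S.assigned := by
      by_contra h
      exact hb' (hC.closed y hy b' h hyb)
    have hbbd : b' ∈ bd := ⟨hbA, hq b' hbq, y, hy, hyb.symm⟩
    have hq'' : ∀ x ∈ q'.support, x ∈ C ∪ bd := fun x hx ↦
      (hq' x hx).imp id fun h ↦ by rwa [Set.mem_singleton_iff.1 h]
    have hreach : ∃ s ∈ bd, ∃ q : G.Walk a s, ∀ x ∈ q.support, x ∈ C ∪ bd :=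
      ⟨b', hbbd, q', hq''⟩
    refine ⟨ha, hreach, ?_⟩
    exact ((hdp a (fun h ↦ hbdC a h ha) hreach).2.2.2.1 b' hbbd q' hq'').trans_lt
      (hl'.trans_lt hl)
  -- If `N` were empty, `R = K = C` would certify that `C` is already buffered from `X`.
  have hNne : ∃ u, u ∈ N := by
    by_contra! hN
    refine hbuf ⟨C, C, hu₀, subset_rfl, ?_, ?_, ?_, ?_⟩
    · exact fun x hx y hy hxy ↦ by_contra fun h ↦ hy (hC.closed x hx y h hxy)
    · exact fun x hx y hy hxy ↦ by_contra fun h ↦ hy (hC.closed x hx y h hxy)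
    · exact fun x hx ↦ ⟨fun h ↦ hC.unassigned x h hx.1, fun y hy hxy ↦ hXC ⟨x, hx, y, hy, hxy⟩⟩
    · intro a ha b hb q hq
      by_contra! hl
      exact hN a (hexit a ha b hb q hq hl)
  have hbuf' : ∀ u ∈ C, u ∉ N → S'.Buffered w γ (S.loc s) u := by
    intro u hu huN
    refine ⟨C, C \ N, ⟨hu, huN⟩, Set.sdiff_subset, ?_, ?_, ?_, ?_⟩
    · exact fun x hx y hy hxy ↦ Or.inl (by_contra fun h ↦ hy (hC.closed x hx y h hxy))
    · intro x hx y hy hxy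
      by_cases hyA : y ∈ S.assigned
      · exact Or.inl hyA
      · exact Or.inr (by_contra fun h ↦ hy ⟨hC.closed x hx.1 y hyA hxy, h⟩)
    · rintro x ⟨hx, hxs⟩
      have hxA : x ∈ S.assigned := by
        by_contra hxA
        exact hXC (hE.adj_of_new x hx hxA s hs hxs)
      rw [hlocA x hxA] at hxs
      exact ⟨fun h ↦ hC.unassigned x h hxA, fun y hy hxy ↦ hXC ⟨x, ⟨hxA, hxs⟩, y, hy, hxy⟩⟩
    · intro a ha b hb q hq
      by_contra! hl
      exact ha.2 (hexit a ha.1 b hb q (fun x hx ↦ hE.dom_subset s hs (hq x hx)) hl)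
  -- the supernodes that receive vertices are adjacent to `X`
  have hmem : ∀ b ∈ bd, S.loc s ∈ S.adjAncestors (S.loc b) := by
    rintro b ⟨hbA, hXb, y, hy, hby⟩
    have hne : S.loc s ≠ S.loc b := fun h ↦ hXC ⟨b, ⟨hbA, h.symm⟩, y, hy, hby⟩
    refine ⟨hX, hXb, hne, (hS.buffer b hbA _ hX hXb hne).resolve_right fun h ↦ hbuf ?_⟩
    exact (h y (hS.loc_suffix y (hC.unassigned y hy) b hby.symm)).of_mem_component hC hy hu₀
  have hnotbuf : ∀ y ∈ C, ¬ S.Buffered w γ (S.loc s) y := fun y hy h ↦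
    hbuf (h.of_mem_component hC hy hu₀)
  have hradius : ∀ v ∈ N, ∀ y ∈ C, G.Adj (F v) y → S'.RadiusLE w v
      (γ * ({X ∈ S.adjAncestors (S.loc (F v)) | S.Buffered w γ X y}.ncard + 1)) := by
    intro v hv y hy hvy
    obtain ⟨hb, q, hq, hl⟩ := hwalk v hv
    obtain ⟨t, ht, q', hq', hl'⟩ := hS.boundary_radius _ hb.1 y (hC.unassigned y hy) hvy
    refine ⟨t, by rwa [hlocN v hv], q.append q', fun x hx ↦ ?_, ?_⟩
    · rw [hlocN v hv]
      rw [SimpleGraph.Walk.mem_support_append_iff] at hx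
      rcases hx with hx | hx
      · obtain ⟨h1, h2 | h2⟩ := hq x hx
        · exact ⟨Or.inr h2, by rw [hlocN x h2, h1]⟩
        · rw [h2]
          exact hE.cell_subset _ (mem_cell hb.1)
      · exact hE.cell_subset _ (hq' x hx)
    · rw [walkLength_append, hl, mul_add, mul_one, add_comm]
      exact add_le_add hl' hv.2.2.le
  refine ⟨S', ?_, Set.ssubset_iff_subset_ne.2 ⟨hE.subset, fun h ↦ ?_⟩⟩
  swap
  · obtain ⟨u, hu⟩ := hNne
    exact hC.unassigned u hu.1 (h ▸ Or.inr hu)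
  have hold : ∀ v ∈ S'.assigned, ∃ b ∈ S.assigned, S'.loc v = S.loc b := by
    rintro v (hv | hv)
    · exact ⟨v, hv, hlocA v hv⟩
    · exact ⟨F v, (hwalk v hv).1.1, hlocN v hv⟩
  refine ⟨?_, ?_, ?_, ?_, ?_, ?_, ?_, ?_, ?_, ?_⟩
  · intro v s k h
    obtain ⟨v', hv'⟩ := hloc_ex v
    obtain ⟨h1, h2⟩ := hS.source v' s k (hv' ▸ h)
    exact ⟨Or.inl h1, by rw [hlocA s h1, h2]⟩
  · obtain ⟨v₀, h⟩ := hS.root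
    refine ⟨v₀, fun v ↦ ?_⟩
    obtain ⟨v', hv'⟩ := hloc_ex v
    rw [hv']
    exact h v'
  · intro u hu v huv
    have huA : u ∉ S.assigned := fun h ↦ hu (Or.inl h)
    rw [hloc u fun h ↦ hu (Or.inr h)]
    exact (hloc_le v).trans (hS.loc_suffix u huA v huv)
  · rintro u hu v hv huv
    by_cases huA : u ∈ S.assigned <;> by_cases hvA : v ∈ S.assigned
    · rw [hlocA u huA, hlocA v hvA]
      exact hS.comparable u huA v hvA huv
    · rw [hlocA u huA]
      exact List.suffix_or_suffix_of_suffix (hS.loc_suffix v hvA u huv.symm) (hloc_le v)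
    · rw [hlocA v hvA]
      exact List.suffix_or_suffix_of_suffix (hloc_le u) (hS.loc_suffix u huA v huv)
    · have h := hk u (hu.resolve_left huA).1 ▸ hloc_le u
      have h' := hk v (hv.resolve_left hvA).1 ▸ hloc_le v
      exact List.suffix_or_suffix_of_suffix h h'
  · intro v hv
    obtain ⟨b, hb, h⟩ := hold v hv
    rw [h]
    exact hE.isSkeleton hS hb
  · intro v hv
    obtain ⟨b, hb, h⟩ := hold v hv
    rw [h]
    exact hE.skel_subset hS hb
  · intro v hv Y hY hYv hne
    obtain ⟨b, hb, h⟩ := hold v hv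
    rw [h] at hYv hne ⊢
    exact hE.buffer hS hb hY hYv hne
  · intro v hv
    obtain ⟨b, hb, h⟩ := hold v hv
    rw [h, hE.adjAncestors_eq hS hb]
    exact hS.ncard_le b hb
  · rintro v (hv | hv)
    · exact hE.radiusLE hv (hS.radius v hv) le_rfl
    · have hb := (hwalk v hv).1
      obtain ⟨y, hy, hby⟩ := hb.2.2
      obtain ⟨t, ht, q, hq, hl⟩ := hradius v hv y hy hby
      refine ⟨t, ht, q, hq, hl.trans (mul_le_mul_of_nonneg_left ?_ (zero_le (a := γ)))⟩
      have h1 := Set.ncard_le_ncard (Set.sep_subset (S.adjAncestors (S.loc (F v)))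
        (fun X ↦ S.Buffered w γ X y)) (finite_adjAncestors _)
      -- At most `r - 2` earlier charges plus the present one stay within `r`.
      have h2 := hS.ncard_le _ hb.1
      exact_mod_cast (by omega : _ + 1 ≤ r)
  · intro v hv u hu hvu
    rcases hv with hv | hv
    · exact hE.boundary_radius hS hv hu hvu
    have huC : u ∈ C := hC.closed v hv.1 u (fun h ↦ hu (Or.inl h)) hvu
    have huN : u ∉ N := fun h ↦ hu (Or.inr h)
    have hb := (hwalk v hv).1
    obtain ⟨y, hy, hby⟩ := hb.2.2
    obtain ⟨t, ht, q, hq, hl⟩ := hradius v hv y hy hby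
    refine ⟨t, ht, q, hq, hl.trans (mul_le_mul_of_nonneg_left ?_ (zero_le (a := γ)))⟩
    rw [hlocN v hv, hE.adjAncestors_eq hS hb.1]
    have hfin : {X ∈ S.adjAncestors (S.loc (F v)) | S.Buffered w γ X y}.Finite :=
      (finite_adjAncestors _).subset (Set.sep_subset _ _)
    -- The extra `γ` is paid for by `X`, which was not counted at `y` before and is counted at `u`
    -- now.
    have hnot : S.loc s ∉ {X ∈ S.adjAncestors (S.loc (F v)) | S.Buffered w γ X y} :=
      fun h ↦ hnotbuf y hy h.2
    have h1 := Set.ncard_insert_of_notMem hnot hfin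
    have h2 : insert (S.loc s) {X ∈ S.adjAncestors (S.loc (F v)) | S.Buffered w γ X y} ⊆
        {X ∈ S.adjAncestors (S.loc (F v)) | S'.Buffered w γ X u} := by
      rintro Y (rfl | ⟨hY, hYy⟩)
      · exact ⟨hmem _ hb, hbuf' u huC huN⟩
      · refine ⟨hY, ?_⟩
        obtain ⟨s', hs', rfl⟩ := hS.exists_loc_eq hY.1 hY.2.1
        exact hE.buffered hs' (hYy.of_mem_component hC hy huC)
    have h3 := Set.ncard_le_ncard h2 ((finite_adjAncestors _).subset (Set.sep_subset _ _))
    exact_mod_cast h1 ▸ h3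

/-! ### Adding a supernode -/

/-- If the component `C` is buffered from each of its ancestors that is not adjacent to it, then
a new supernode can be created in `C`. -/
theorem Valid.exists_new_supernode (hw : ∀ e ∈ G.edgeSet, 0 < w e) (hG : CliqueMinorFree G r)
    (hS : S.Valid w γ r) (hC : S.IsComponent C) {k : List V} (hk : ∀ v ∈ C, S.loc v = k)
    (hbuf : ∀ X, X ≠ [] → X <:+ k → AdjSets G (S.cell X) C ∨ ∀ u ∈ C, S.Buffered w γ X u) :
    ∃ S' : PartialDecomposition G, S'.Valid w γ r ∧ S.assigned ⊂ S'.assigned := by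
  classical
  obtain ⟨s, hs⟩ := hC.nonempty
  have hsA := hC.unassigned s hs
  let P : Set (List V) := {X | X ≠ [] ∧ X <:+ k ∧ AdjSets G (S.cell X) C}
  have hPex : ∀ X, X ≠ [] → X <:+ k → ∃ v ∈ S.assigned, S.loc v = X := fun X hX hXk ↦
    hS.exists_loc_eq hX (v := s) (by rwa [hk s hs])
  have hPfin : P.Finite := (k.tails.toFinset.finite_toSet).subset fun X hX ↦ by
    simpa using hX.2.1
  -- Otherwise `X` would be buffered from the domain of `Y`, which contains the neighbour `u` of `X`
  -- in `C`.
  have hPadj : ∀ X ∈ P, ∀ Y ∈ P, X ≠ Y → X <:+ Y → AdjSets G (S.cell X) (S.cell Y) := by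
    rintro X ⟨hX, hXk, x, hx, u, hu, hxu⟩ Y ⟨hY, hYk, -⟩ hne hXY
    obtain ⟨v, hv, rfl⟩ := hPex Y hY hYk
    refine (hS.buffer v hv X hX hXY hne).resolve_right fun h ↦ ?_
    exact (h u (by rw [dom, Set.mem_ofPred_eq, hk u hu]; exact hYk)).not_adj x hx hxu
  -- The members of `P` together with `C` (the value at `none`) are the branch sets of a clique
  -- minor.
  have hPcard : P.ncard + 2 ≤ r := by
    have := hPfin.fintype
    have h := card_lt_of_cliqueMinorFree hG
      (fun o : Option P ↦ o.elim C fun X ↦ S.cell X) ?_ ?_ ?_ ?_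
    · rw [Fintype.card_option, ← Nat.card_eq_fintype_card, Nat.card_coe_set_eq] at h
      omega
    · rintro (_ | ⟨X, hX, hXk, -⟩)
      · exact hC.nonempty
      · obtain ⟨v, hv, rfl⟩ := hPex X hX hXk
        exact ⟨v, mem_cell hv⟩
    · rintro (_ | ⟨X, hX, hXk, -⟩)
      · exact hC.linked
      · obtain ⟨v, hv, rfl⟩ := hPex X hX hXk
        exact hS.linked_cell hv
    · rintro (_ | ⟨X, hX⟩) (_ | ⟨Y, hY⟩) hne
      · exact absurd rfl hne
      · exact Set.disjoint_left.2 fun x hx hx' ↦ hC.unassigned x hx hx'.1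
      · exact Set.disjoint_left.2 fun x hx hx' ↦ hC.unassigned x hx' hx.1
      · refine Set.disjoint_left.2 fun x hx hx' ↦ hne ?_
        obtain rfl : X = Y := hx.2.symm.trans hx'.2
        rfl
    · rintro (_ | ⟨X, hX⟩) (_ | ⟨Y, hY⟩) hne
      · exact absurd rfl hne
      · exact hY.2.2.symm
      · exact hX.2.2
      · have hne' : X ≠ Y := by
          rintro rfl
          exact hne rfl
        rcases List.suffix_or_suffix_of_suffix hX.2.1 hY.2.1 with h | h
        · exact hPadj X hX Y hY hne' h
        · exact (hPadj Y hY X hX hne'.symm h).symm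
  -- Putting one neighbour of each member of `P` into the skeleton makes the new supernode adjacent
  -- to all of `P`.
  have hch : ∀ X, ∃ y ∈ C, X ∈ P → ∃ x ∈ S.cell X, G.Adj x y := fun X ↦ by
    by_cases hX : X ∈ P
    · obtain ⟨x, hx, y, hy, hxy⟩ := hX.2.2
      exact ⟨y, hy, fun _ ↦ ⟨x, hx, hxy⟩⟩
    · exact ⟨s, hs, fun h ↦ absurd h hX⟩
  choose f hfC hf using hch
  obtain ⟨T, hsT, hfT, hT⟩ := exists_isSkeleton hw hC.linked hs (U := f '' P)
    (by rintro _ ⟨X, -, rfl⟩; exact hfC X)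
  have hTC : T.verts ⊆ C := hT.subset
  have hleaves : (leaves T).encard ≤ ((r - 1 : ℕ) : ℕ∞) := by
    have h := Set.ncard_image_le (f := f) hPfin
    refine hT.leaves_le.trans ?_
    exact_mod_cast (by omega : (f '' P).ncard + 1 ≤ r - 1)
  let S' : PartialDecomposition G :=
    { assigned := S.assigned ∪ T.verts
      loc := fun v ↦ if v ∈ C then s :: k else S.loc v
      skel := Function.update S.skel (s :: k) T }
  have hlocC : ∀ v ∈ C, S'.loc v = s :: k := fun v hv ↦ if_pos hv
  have hloc : ∀ v ∉ C, S'.loc v = S.loc v := fun v hv ↦ if_neg hv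
  have hlocA : ∀ v ∈ S.assigned, S'.loc v = S.loc v := fun v hv ↦
    hloc v fun h ↦ hC.unassigned v h hv
  -- A label in use has an assigned head, so the unassigned source `s` makes `s :: k` new.
  have hfresh : ∀ v, ¬ s :: k <:+ S.loc v := fun v h ↦ hsA (hS.source v s k h).1
  have hfresh' : ∀ v, S.loc v ≠ s :: k := fun v h ↦ hfresh v (h ▸ List.suffix_refl _)
  have hskel : S'.skel (s :: k) = T := Function.update_self ..
  have hE : S.Extends S' C :=
    { isComponent := hC
      subset := Set.subset_union_left
      mem_of_new := fun v hv hvA ↦ hTC (hv.resolve_left hvA)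
      loc_eq := hlocA
      dom_subset := by
        intro v hv x hx
        by_cases hxC : x ∈ C
        · rw [dom, Set.mem_ofPred_eq, hlocC x hxC, List.suffix_cons_iff] at hx
          rw [dom, Set.mem_ofPred_eq, hk x hxC]
          exact hx.resolve_left (hfresh' v)
        · rwa [dom, Set.mem_ofPred_eq, hloc x hxC] at hx
      adj_of_new := by
        intro v hv hvA u _ huv
        rw [hlocC v (hTC (hv.resolve_left hvA))] at huv
        exact absurd huv.symm (hfresh' u)
      skel_eq := fun v _ ↦ Function.update_of_ne (hfresh' v) _ _ }
  have hcell : S'.cell (s :: k) = T.verts := by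
    ext x
    constructor
    · rintro ⟨hx | hx, h⟩
      · exact absurd ((hlocA x hx).symm.trans h) (hfresh' x)
      · exact hx
    · exact fun hx ↦ ⟨Or.inr hx, hlocC x (hTC hx)⟩
  have hdom : S'.dom (s :: k) = C := by
    ext x
    constructor
    · intro hx
      by_contra hxC
      rw [dom, Set.mem_ofPred_eq, hloc x hxC] at hx
      exact hfresh x hx
    · intro hx
      rw [dom, Set.mem_ofPred_eq, hlocC x hx]
  have hcell_old : ∀ X, X ≠ s :: k → S'.cell X = S.cell X := by
    intro X hX
    refine (Set.Subset.antisymm ?_ (hE.cell_subset X))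
    rintro x ⟨hx | hx, h⟩
    · exact ⟨hx, by rw [← h, hlocA x hx]⟩
    · exact absurd (h.symm.trans (hlocC x (hTC hx))) hX
  have hcons : ∀ X : List V, X <:+ s :: k → X ≠ s :: k → X <:+ k := fun X h hne ↦
    (List.suffix_cons_iff.1 h).resolve_left hne
  refine ⟨S', ?_, Set.ssubset_iff_subset_ne.2 ⟨hE.subset, fun h ↦ ?_⟩⟩
  swap
  · exact hsA (h ▸ Or.inr hsT)
  refine ⟨?_, ?_, ?_, ?_, ?_, ?_, ?_, ?_, ?_, ?_⟩
  · intro v s' k' h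
    have key : s' :: k' <:+ S.loc v → s' ∈ S'.assigned ∧ S'.loc s' = s' :: k' := fun h ↦ by
      obtain ⟨h1, h2⟩ := hS.source v s' k' h
      exact ⟨Or.inl h1, by rw [hlocA s' h1, h2]⟩
    by_cases hv : v ∈ C
    · rw [hlocC v hv, List.suffix_cons_iff] at h
      rcases h with h | h
      · obtain ⟨rfl, rfl⟩ := List.cons.inj h
        exact ⟨Or.inr hsT, hlocC _ hs⟩
      · exact key (hk v hv ▸ h)
    · exact key (hloc v hv ▸ h)
  · obtain ⟨v₀, h⟩ := hS.root
    refine ⟨v₀, fun v ↦ ?_⟩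
    by_cases hv : v ∈ C
    · rw [hlocC v hv]
      exact (hk v hv ▸ h v).trans (List.suffix_cons _ _)
    · rw [hloc v hv]
      exact h v
  · intro u hu v huv
    have huA : u ∉ S.assigned := fun h ↦ hu (Or.inl h)
    by_cases huC : u ∈ C <;> by_cases hvC : v ∈ C
    · rw [hlocC u huC, hlocC v hvC]
    · rw [hlocC u huC, hloc v hvC]
      exact (hk u huC ▸ hS.loc_suffix u huA v huv).trans (List.suffix_cons _ _)
    · exact absurd (hC.closed v hvC u huA huv.symm) huC
    · rw [hloc u huC, hloc v hvC]
      exact hS.loc_suffix u huA v huv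
  · have key : ∀ u ∈ C, ∀ v ∈ S.assigned, G.Adj u v → S'.loc v <:+ S'.loc u := by
      intro u hu v hv huv
      rw [hlocC u hu, hlocA v hv]
      exact (hk u hu ▸ hS.loc_suffix u (hC.unassigned u hu) v huv).trans (List.suffix_cons _ _)
    rintro u (hu | hu) v (hv | hv) huv
    · rw [hlocA u hu, hlocA v hv]
      exact hS.comparable u hu v hv huv
    · exact Or.inl (key v (hTC hv) u hu huv.symm)
    · exact Or.inr (key u (hTC hu) v hv huv)
    · rw [hlocC u (hTC hu), hlocC v (hTC hv)]
      exact Or.inl (List.suffix_refl _)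
  · rintro v (hv | hv)
    · rw [hlocA v hv]
      exact hE.isSkeleton hS hv
    · rw [hlocC v (hTC hv), hskel, hdom]
      exact { hT with leaves_le := hleaves }
  · rintro v (hv | hv)
    · rw [hlocA v hv]
      exact hE.skel_subset hS hv
    · rw [hlocC v (hTC hv), hskel, hcell]
  · rintro v (hv | hv) X hX hXv hne
    · rw [hlocA v hv] at hXv hne ⊢
      exact hE.buffer hS hv hX hXv hne
    · rw [hlocC v (hTC hv)] at hXv hne ⊢
      have hXk := hcons X hXv hne
      by_cases hadj : AdjSets G (S.cell X) C
      · obtain ⟨x, hx, hxy⟩ := hf X ⟨hX, hXk, hadj⟩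
        refine Or.inl ⟨x, hE.cell_subset X hx, f X, ?_, hxy⟩
        rw [hcell]
        exact hfT ⟨X, ⟨hX, hXk, hadj⟩, rfl⟩
      · refine Or.inr fun u hu ↦ ?_
        rw [hdom] at hu
        obtain ⟨v', hv', rfl⟩ := hPex X hX hXk
        exact hE.buffered hv' ((hbuf _ hX hXk).resolve_left hadj u hu)
  · rintro v (hv | hv)
    · rw [hlocA v hv, hE.adjAncestors_eq hS hv]
      exact hS.ncard_le v hv
    · rw [hlocC v (hTC hv)]
      refine le_trans (Nat.add_le_add_right (Set.ncard_le_ncard ?_ hPfin) 2) hPcard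
      rintro X ⟨hX, hXv, hne, hadj⟩
      rw [hcell, hcell_old X hne] at hadj
      exact ⟨hX, hcons X hXv hne, hadj.mono subset_rfl hTC⟩
  · rintro v (hv | hv)
    · exact hE.radiusLE hv (hS.radius v hv) le_rfl
    · refine ⟨v, ?_, .nil, ?_, by simp⟩
      · rwa [hlocC v (hTC hv), hskel]
      · rw [hlocC v (hTC hv), hcell]
        simpa using hv
  · rintro v (hv | hv) u hu huv
    · exact hE.boundary_radius hS hv hu huv
    · refine ⟨v, ?_, .nil, ?_, by simp⟩
      · rwa [hlocC v (hTC hv), hskel]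
      · rw [hlocC v (hTC hv), hcell]
        simpa using hv

/-! ### The construction -/

theorem Valid.exists_step (hw : ∀ e ∈ G.edgeSet, 0 < w e) (hG : CliqueMinorFree G r)
    (hS : S.Valid w γ r) (hne : S.assigned ≠ Set.univ) :
    ∃ S' : PartialDecomposition G, S'.Valid w γ r ∧ S.assigned ⊂ S'.assigned := by
  obtain ⟨a, ha⟩ := (Set.ne_univ_iff_exists_notMem _).1 hne
  obtain ⟨C, hCA, haC, hlink, hcl⟩ := exists_linked_component (G := G) S.assignedᶜ a ha
  have hC : S.IsComponent C := ⟨⟨a, haC⟩, hCA, hlink, hcl⟩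
  obtain ⟨k, hk⟩ := hS.loc_const hC
  by_cases h : ∀ X, X ≠ [] → X <:+ k → AdjSets G (S.cell X) C ∨ ∀ u ∈ C, S.Buffered w γ X u
  · exact hS.exists_new_supernode hw hG hC hk h
  · push Not at h
    obtain ⟨X, hX, hXk, hXC, u, hu, hbuf⟩ := h
    exact hS.exists_grow_buffer hw hC hk hX hXk hXC hu hbuf

theorem exists_valid_initial {V : Type*} [Nonempty V] {G : SimpleGraph V} {r : ℕ} (w : Sym2 V → ℝ≥0) (γ : ℝ≥0)
    (hG : CliqueMinorFree G r) : ∃ S : PartialDecomposition G, S.Valid w γ r := by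
  obtain ⟨v₀⟩ := ‹Nonempty V›
  -- A single vertex is a model of the one-vertex clique; the one leaf of the initial skeleton needs
  -- `1 ≤ r - 1`.
  have hr : 2 ≤ r := by
    have h := card_lt_of_cliqueMinorFree hG (fun _ : Unit ↦ {v₀}) (fun _ ↦ ⟨v₀, rfl⟩) ?_
      (fun a b h ↦ absurd rfl h) (fun a b h ↦ absurd rfl h)
    · rw [Fintype.card_unit] at h
      omega
    · rintro - a rfl b rfl
      exact ⟨.nil, by simp⟩
  let T : G.Subgraph := G.singletonSubgraph v₀
  have hTv : T.verts = {v₀} := rfl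
  let S : PartialDecomposition G :=
    { assigned := {v₀}
      loc := fun _ ↦ [v₀]
      skel := fun _ ↦ T }
  have hcell : S.cell [v₀] = {v₀} := by
    ext x
    exact and_iff_left rfl
  have hrad : ∀ v ∈ S.assigned, ∀ ρ, S.RadiusLE w v ρ := by
    rintro v hv ρ
    refine ⟨v, hv, .nil, ?_, by simp⟩
    simpa [hcell, S] using hv
  refine ⟨S, ?_, ⟨v₀, fun v ↦ List.suffix_refl _⟩, fun u _ v _ ↦ List.suffix_refl _,
    fun u _ v _ _ ↦ Or.inl (List.suffix_refl _), ?_, ?_, ?_, ?_, ?_, ?_⟩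
  · intro v s k h
    have h' : s = v₀ ∧ k = [] := by simpa [S, List.suffix_cons_iff] using h
    obtain ⟨rfl, rfl⟩ := h'
    exact ⟨rfl, rfl⟩
  · intro v _
    refine ⟨?_, fun x _ ↦ List.suffix_refl _, ⟨v₀, rfl, ?_⟩, ?_⟩
    · have : Subsingleton T.verts := by rw [hTv]; infer_instance
      have : Nonempty T.verts := ⟨⟨v₀, rfl⟩⟩
      exact SimpleGraph.IsTree.of_subsingleton
    · intro v hv q _
      obtain rfl : v₀ = v := (Set.mem_singleton_iff.1 hv).symm
      exact ⟨.nil, le_rfl, by simp⟩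
    · refine (Set.encard_le_encard (t := {v₀}) fun x hx ↦ hx.1).trans ?_
      rw [Set.encard_singleton]
      exact_mod_cast (by omega : 1 ≤ r - 1)
  · intro v _
    exact hcell.ge
  · intro v _ X hX hXv hne
    have h' : X = [v₀] ∨ X = [] := by simpa [S, List.suffix_cons_iff] using hXv
    exact absurd h' (not_or.2 ⟨hne, hX⟩)
  · intro v _
    have : S.adjAncestors (S.loc v) = ∅ := by
      refine Set.eq_empty_of_forall_notMem ?_
      rintro X ⟨hX, hXv, hne, -⟩
      have h' : X = [v₀] ∨ X = [] := by simpa [S, List.suffix_cons_iff] using hXv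
      exact absurd h' (not_or.2 ⟨hne, hX⟩)
    rw [this, Set.ncard_empty]
    omega
  · exact fun v hv ↦ hrad v hv _
  · exact fun v hv _ _ _ ↦ hrad v hv _

theorem exists_valid_univ [Nonempty V] (hw : ∀ e ∈ G.edgeSet, 0 < w e)
    (hG : CliqueMinorFree G r) :
    ∃ S : PartialDecomposition G, S.Valid w γ r ∧ S.assigned = Set.univ := by
  -- Maximality is taken over assigned sets, of which there are finitely many, rather than over
  -- states.
  obtain ⟨A, hA⟩ := (Set.toFinite
    {A : Set V | ∃ S : PartialDecomposition G, S.Valid w γ r ∧ S.assigned = A}).exists_maximal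
      (by
        obtain ⟨S, hS⟩ := exists_valid_initial w γ hG
        exact ⟨_, S, hS, rfl⟩)
  obtain ⟨S, hS, rfl⟩ := hA.prop
  refine ⟨S, hS, ?_⟩
  by_contra hne
  obtain ⟨S', hS', hlt⟩ := hS.exists_step hw hG hne
  exact hA.not_prop_of_gt hlt ⟨S', hS', rfl⟩

end PartialDecomposition

end Steps

section PartitionTree

variable {V : Type u} {G : SimpleGraph V}

namespace PartialDecomposition

variable {w : Sym2 V → ℝ≥0} {γ : ℝ≥0} {S : PartialDecomposition G} {r : ℕ}

/-! ### The partition tree -/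

variable (S) in
/-- The labels of the supernodes. -/
abbrev Label : Type u := {l : List V // ∃ v, S.loc v = l}

instance [Finite V] : Finite S.Label := Set.finite_range S.loc

variable (S) in
/-- The partition tree: a label is joined to its tail. -/
def labelTree : SimpleGraph S.Label where
  Adj i j := (∃ a, i.1 = a :: j.1) ∨ ∃ a, j.1 = a :: i.1
  symm := ⟨fun _ _ h ↦ h.symm⟩
  loopless := ⟨fun i h ↦ by
    rcases h with ⟨a, h⟩ | ⟨a, h⟩ <;> exact absurd (congrArg List.length h) (by simp)⟩

theorem Valid.exists_root [Nonempty V] (hS : S.Valid w γ r) :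
    ∃ ρ : S.Label, ∀ i : S.Label, ρ.1 <:+ i.1 ∧ (i ≠ ρ → ∃ (j : S.Label) (a : V), i.1 = a :: j.1) ∧
      ∀ a, ρ.1 ≠ a :: i.1 := by
  obtain ⟨v₀, h⟩ := hS.root
  have hroot : ∃ v, S.loc v = [v₀] := by
    obtain ⟨v⟩ := ‹Nonempty V›
    exact ⟨v₀, (hS.source v v₀ [] (h v)).2⟩
  refine ⟨⟨[v₀], hroot⟩, ?_⟩
  rintro ⟨l, v, hl⟩
  have hv : [v₀] <:+ l := hl ▸ h v
  refine ⟨hv, fun hne ↦ ?_, fun a ha ↦ ?_⟩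
  · cases l with
    | nil => simp at hv
    | cons a k =>
      rw [List.suffix_cons_iff] at hv
      have hk : [v₀] <:+ k := hv.resolve_left fun h ↦ hne (Subtype.ext h.symm)
      have hk' : k ≠ [] := by
        rintro rfl
        simp at hk
      obtain ⟨s, -, hs⟩ := hS.exists_loc_eq hk' (hl ▸ List.suffix_cons a k)
      exact ⟨⟨k, s, hs⟩, a, rfl⟩
  · obtain rfl : [] = l := (List.cons.inj ha).2
    simp at hv

theorem Valid.labelTree_isTree [Finite V] [Nonempty V] (hS : S.Valid w γ r) : S.labelTree.IsTree := by
  obtain ⟨ρ, hρ⟩ := hS.exists_root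
  have hpar : ∀ i : S.Label, ∃ j : S.Label, i ≠ ρ → ∃ a, i.1 = a :: j.1 := fun i ↦ by
    by_cases hi : i = ρ
    · exact ⟨i, fun h ↦ absurd hi h⟩
    · obtain ⟨j, h⟩ := (hρ i).2.1 hi
      exact ⟨j, fun _ ↦ h⟩
  choose p hp using hpar
  have key : ∀ i j : S.Label, (∃ a, i.1 = a :: j.1) ↔ i ≠ ρ ∧ p i = j := by
    intro i j
    constructor
    · rintro ⟨a, ha⟩
      have hi : i ≠ ρ := by
        rintro rfl
        exact (hρ j).2.2 a ha
      obtain ⟨b, hb⟩ := hp i hi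
      exact ⟨hi, Subtype.ext (List.cons.inj (hb.symm.trans ha)).2⟩
    · rintro ⟨hi, rfl⟩
      exact hp i hi
  refine isTree_of_parent _ ρ p (fun i ↦ i.1.length) (fun i hi ↦ ?_) fun i j ↦ ?_
  · obtain ⟨a, ha⟩ := hp i hi
    simp [ha]
  · exact or_congr (key i j) (key j i)

/-- The branch of the partition tree between a label and one of its suffixes. -/
theorem Valid.exists_path_of_suffix [Finite V] (hS : S.Valid w γ r) {X : S.Label} (hX : X.1 ≠ [])
    (j : S.Label) (h : X.1 <:+ j.1) : ∃ q : S.labelTree.Walk X j, q.IsPath ∧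
      ∀ i : S.Label, i ∈ q.support ↔ X.1 <:+ i.1 ∧ i.1 <:+ j.1 := by
  induction j using rank_induction (fun j : S.Label ↦ j.1.length) with
  | h j ih =>
    by_cases hj : X = j
    · subst hj
      refine ⟨.nil, by simp, fun i ↦ ?_⟩
      rw [SimpleGraph.Walk.mem_support_nil_iff]
      exact ⟨fun h ↦ h ▸ ⟨List.suffix_refl _, List.suffix_refl _⟩,
        fun h ↦ Subtype.ext (h.2.sublist.antisymm h.1.sublist)⟩
    obtain ⟨_ | ⟨a, k⟩, v, hv⟩ := j
    · exact absurd (List.suffix_nil.1 h) hX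
    have hXk : X.1 <:+ k := (List.suffix_cons_iff.1 h).resolve_left fun h ↦ hj (Subtype.ext h)
    have hk : k ≠ [] := by
      rintro rfl
      exact hX (List.suffix_nil.1 hXk)
    obtain ⟨s, -, hs⟩ := hS.exists_loc_eq hk (hv ▸ List.suffix_cons a k)
    obtain ⟨q, hq, hsupp⟩ := ih ⟨k, s, hs⟩ (by simp) hXk
    have hadj : S.labelTree.Adj ⟨k, s, hs⟩ ⟨a :: k, v, hv⟩ := Or.inr ⟨a, rfl⟩
    refine ⟨q.concat hadj, hq.concat (fun h ↦ ?_) hadj, fun i ↦ ?_⟩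
    · exact absurd ((hsupp _).1 h).2.length_le (by simp)
    · rw [SimpleGraph.Walk.support_concat, List.mem_append, List.mem_singleton, hsupp,
        List.suffix_cons_iff]
      constructor
      · rintro (⟨h1, h2⟩ | rfl)
        · exact ⟨h1, Or.inr h2⟩
        · exact ⟨h, Or.inl rfl⟩
      · rintro ⟨h1, h2 | h2⟩
        · exact Or.inr (Subtype.ext h2)
        · exact Or.inl ⟨h1, h2⟩

/-- A valid decomposition in which all vertices are assigned is a buffered cop decomposition. -/
theorem Valid.exists_isBuffered [Finite V] [Nonempty V] (hS : S.Valid w γ r) (hA : S.assigned = Set.univ)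
    {Δ : ℝ≥0} (hΔ : γ * r ≤ Δ) :
    ∃ D : CopDecomposition G S.Label, D.IsBuffered w Δ γ (r - 1) := by
  classical
  have hmem : ∀ v, v ∈ S.assigned := fun v ↦ hA ▸ Set.mem_univ v
  obtain ⟨ρ, hρ⟩ := hS.exists_root
  have hT := hS.labelTree_isTree
  have hne : ∀ i : S.Label, i.1 ≠ [] := by
    intro i hi
    have h := (hρ i).1
    rw [hi, List.suffix_nil] at h
    by_cases hiρ : i = ρ
    · obtain ⟨v₀, h₀⟩ := hS.root
      obtain ⟨v, hv⟩ := i.2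
      have := h₀ v
      rw [hv, hi] at this
      simp at this
    · exact hiρ (Subtype.ext (hi.trans h.symm))
  let D : CopDecomposition G S.Label :=
    { supernode := fun i ↦ S.cell i.1
      disjoint := fun i j hij ↦ Set.disjoint_left.2 fun x hi hj ↦
        hij (Subtype.ext (hi.2.symm.trans hj.2))
      cover := fun v ↦ ⟨⟨S.loc v, v, rfl⟩, mem_cell (hmem v)⟩
      skeleton := fun i ↦ S.skel i.1
      skeleton_isTree := by
        rintro ⟨_, v, rfl⟩
        exact (hS.isSkeleton v (hmem v)).isTree
      skeleton_le := by
        rintro ⟨_, v, rfl⟩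
        exact le_inducedOn (hS.skel_subset v (hmem v))
      tree := S.labelTree
      tree_isTree := hT
      root := ρ }
  have hanc : ∀ i j, D.IsAncestorOrSelf i j ↔ i.1 <:+ j.1 := by
    intro i j
    obtain ⟨q, hq, hsupp⟩ := hS.exists_path_of_suffix (hne ρ) j (hρ j).1
    constructor
    · rintro ⟨p, hp, hi⟩
      have : p = q := congrArg Subtype.val
        ((hT.isAcyclic.subsingleton_path ρ j).elim ⟨p, hp⟩ ⟨q, hq⟩)
      exact ((hsupp i).1 (this ▸ hi)).2
    · exact fun h ↦ ⟨q, hq, (hsupp i).2 ⟨(hρ i).1, h⟩⟩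
  have hdom : ∀ i, D.domVerts i = S.dom i.1 := by
    intro i
    ext v
    constructor
    · rintro ⟨j, hj, -, hv⟩
      have h := (hanc i j).1 hj
      rw [← hv] at h
      exact h
    · exact fun hv ↦ ⟨⟨S.loc v, v, rfl⟩, (hanc _ _).2 hv, mem_cell (hmem v)⟩
  have hbag : ∀ i j : S.Label, j ∈ D.bag i ↔ j = i ∨ j.1 ∈ S.adjAncestors i.1 := by
    intro i j
    refine or_congr Iff.rfl ⟨?_, ?_⟩
    · rintro ⟨⟨h1, h2⟩, h3⟩
      exact ⟨hne j, (hanc j i).1 h1, fun h ↦ h2 (Subtype.ext h), h3⟩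
    · rintro ⟨-, h1, h2, h3⟩
      exact ⟨⟨(hanc j i).2 h1, fun h ↦ h2 (congrArg Subtype.val h)⟩, h3⟩
  -- bags containing `X` form subtrees
  have hbag_le : ∀ i X : S.Label, X ∈ D.bag i → X.1 <:+ i.1 := by
    intro i X h
    rcases (hbag i X).1 h with rfl | h
    · exact List.suffix_refl _
    · exact h.2.1
  have hbag_mid : ∀ i X k : S.Label, X ∈ D.bag i → X.1 <:+ k.1 → k.1 <:+ i.1 → X ∈ D.bag k := by
    intro i X k h hXk hki
    rw [hbag]
    by_cases hne' : X = k
    · exact Or.inl hne'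
    have hne'' : X.1 ≠ k.1 := fun h ↦ hne' (Subtype.ext h)
    rcases (hbag i X).1 h with rfl | h
    · exact absurd (hXk.sublist.antisymm hki.sublist) hne''
    refine Or.inr ⟨hne X, hXk, hne'', ?_⟩
    obtain ⟨-, -, -, x, hx, y, hy, hxy⟩ := h
    obtain ⟨_, v, rfl⟩ := k
    -- If `X` were not adjacent to `k`, it would be buffered from the domain of `k`, which contains
    -- the supernode `i` adjacent to `X`.
    refine (hS.buffer v (hmem v) X.1 (hne X) hXk hne'').resolve_right fun h ↦ ?_
    exact (h y (dom_mono hki (cell_subset_dom _ hy))).not_adj x hx hxy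
  refine ⟨D, ⟨?_, ?_, ?_, ⟨⟨hT, ?_, ?_, ?_⟩, ?_⟩⟩⟩
  · rintro ⟨_, v', rfl⟩ v ⟨hv, hvv⟩
    obtain ⟨t, ht, q, hq, hl⟩ := hS.radius v hv
    rw [hvv] at ht hq
    refine (iInf₂_le t ht).trans ((iInf₂_le q ((toSubgraph_le_inducedOn_iff q).2 hq)).trans ?_)
    exact_mod_cast hl.trans hΔ
  · intro i
    rw [CopDecomposition.dom, hdom]
    obtain ⟨_, v, rfl⟩ := i
    have h := hS.isSkeleton v (hmem v)
    exact ⟨h.isSSSPTree, h.leaves_le⟩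
  · rintro i X ⟨h1, h2⟩
    rw [CopDecomposition.dom, hdom, hdom]
    obtain ⟨_, v, rfl⟩ := i
    refine (hS.buffer v (hmem v) X.1 (hne X) ((hanc _ _).1 h1)
      fun h ↦ h2 (Subtype.ext h)).imp AdjSets.symm fun h u hu ↦ ?_
    obtain ⟨R, K, huK, -, -, -, hXR, hlen⟩ := h u hu
    refine le_iInf₂ fun s hs ↦ le_iInf₂ fun q hq ↦ ?_
    exact_mod_cast hlen u huK s (hXR s hs).1 q ((toSubgraph_le_inducedOn_iff q).1 hq)
  · exact fun v ↦ ⟨⟨S.loc v, v, rfl⟩, ⟨S.loc v, v, rfl⟩, Or.inl rfl, mem_cell (hmem v)⟩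
  · have key : ∀ x y, G.Adj x y → S.loc x <:+ S.loc y → ∃ i, x ∈ D.bagVerts i ∧
        y ∈ D.bagVerts i := by
      intro x y hxy hle
      refine ⟨⟨S.loc y, y, rfl⟩, ⟨⟨S.loc x, x, rfl⟩, ?_, mem_cell (hmem x)⟩,
        ⟨S.loc y, y, rfl⟩, Or.inl rfl, mem_cell (hmem y)⟩
      rw [hbag]
      by_cases h : S.loc x = S.loc y
      · exact Or.inl (Subtype.ext h)
      · exact Or.inr ⟨hne ⟨S.loc x, x, rfl⟩, hle, h, x, mem_cell (hmem x), y, mem_cell (hmem y),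
          hxy⟩
    intro x y hxy
    rcases hS.comparable x (hmem x) y (hmem y) hxy with h | h
    · exact key x y hxy h
    · obtain ⟨i, h1, h2⟩ := key y x hxy.symm h
      exact ⟨i, h2, h1⟩
  · rintro v i j ⟨X, hXi, hv⟩ ⟨Y, hYj, hv'⟩ p hp k hk
    obtain rfl : X = Y := Subtype.ext (hv.2.symm.trans hv'.2)
    obtain ⟨q, -, hq⟩ := hS.exists_path_of_suffix (hne X) i (hbag_le i X hXi)
    obtain ⟨q', -, hq'⟩ := hS.exists_path_of_suffix (hne X) j (hbag_le j X hYj)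
    -- Paths in a tree are unique, so `p` runs inside the two branches joining `X` to `i` and to
    -- `j`.
    have hpq : p = (q.reverse.append q').bypass := congrArg Subtype.val
      ((hT.isAcyclic.subsingleton_path i j).elim ⟨p, hp⟩ (q.reverse.append q').toPath)
    rw [hpq] at hk
    have hk' := SimpleGraph.Walk.support_bypass_subset_support _ hk
    rw [SimpleGraph.Walk.mem_support_append_iff, SimpleGraph.Walk.support_reverse,
      List.mem_reverse, hq, hq'] at hk'
    refine ⟨X, ?_, hv⟩
    rcases hk' with ⟨h1, h2⟩ | ⟨h1, h2⟩
    · exact hbag_mid i X k hXi h1 h2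
    · exact hbag_mid j X k hYj h1 h2
  · intro i
    have hle : Subtype.val '' D.bag i ⊆ insert i.1 (S.adjAncestors i.1) := by
      rintro _ ⟨j, hj, rfl⟩
      rcases (hbag i j).1 hj with rfl | h
      · exact Or.inl rfl
      · exact Or.inr h
    rw [← Subtype.val_injective.encard_image]
    refine (Set.encard_le_encard hle).trans ((Set.encard_insert_le _ _).trans ?_)
    rw [← (finite_adjAncestors i.1).cast_ncard_eq]
    obtain ⟨_, v, rfl⟩ := i
    have := hS.ncard_le v (hmem v)
    exact_mod_cast (by omega : (S.adjAncestors (S.loc v)).ncard + 1 ≤ r - 1)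

end PartialDecomposition

end PartitionTree

end BufferedCop

theorem mainTheorem4 {V : Type u} [Finite V] [Nonempty V] (G : SimpleGraph V)
    (w : Sym2 V → ℝ≥0) (hw : ∀ e ∈ G.edgeSet, 0 < w e)
    (r : ℕ) (hG : BufferedCop.CliqueMinorFree G r)
    (Δ : ℝ≥0) (hΔ : 0 < Δ) :
    ∃ (ι : Type u) (D : BufferedCop.CopDecomposition G ι),
      D.IsBuffered w Δ (Δ / r) (r - 1) := by
  obtain ⟨S, hS, hA⟩ :=
    BufferedCop.PartialDecomposition.exists_valid_univ (γ := Δ / r) hw hG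
  obtain ⟨D, hD⟩ := hS.exists_isBuffered hA (by
    -- For `r = 0` the product is `0`, so the bound is trivial.
    rcases eq_or_ne (r : ℝ≥0) 0 with h | h
    · simp [h]
    · rw [div_mul_cancel₀ _ h])
  exact ⟨S.Label, D, hD⟩
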